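/- Let $0<\beta<\frac12$ and let $\phi:[0,1]\to\mathbb{R}_{\ge 0}$ be a $C^\infty$ function such that $\phi=0$ on $[0,\delta]$ for some $0<\delta<1$, $$\int_0^1 \phi(x)\Big(1+\int_x^1 \phi(z)\frac{dz}{z}\Big)dx=\frac{\beta}{1-2\beta},$$ $$\sup_{a\in[0,1]}\left|\int_0^a\big(\phi'(x)x-(\beta-1)\phi(x)\big)\Big(1+\int_{a^{-1}x}^1\phi(z)\frac{dz}{z}\Big)dx\right|<1,$$ $$\sup_{a\in[0,1]}\left|\int_0^1\Big((\beta-1)+(\beta-1)\int_x^1\phi(z)\frac{dz}{z}+\phi(x)\Big)\Big(\int_{ax}^x\phi(z)\frac{dz}{z}\Big)dx+\int_a^1\phi(x)\frac{dx}{x}\right|<1.$$ Let $e_1,e_2,\dots$ be the standard basis of the real Hilbert space $\ell^2$. Given an integer $K>1$ and real numbers $\gamma_n,\xi_n,\alpha_n,q_n$ ($n\ge K$), define $r_n\in\ell^2$ ($n\ge K-1$) and $d_n\in\ell^2$ ($n\ge K$) by $$r_{K-1}=-\frac{K^{-1/2+\beta}}{\sqrt{K-1}}\sum_{i=1}^{K-1}e_i,\qquad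 d_n=\gamma_n r_{n-1}+h_n+\xi_n e_n,\qquad r_n=r_{n-1}-q_nd_n,$$ where $h_n=\sum_{i=1}^{n-1}\frac{\alpha_n}{n}\phi\left(\frac in\right)e_i$. Then there is $K_0>1$ such that for every integer $K\ge K_0$ the numbers $\gamma_n,\xi_n,\alpha_n,q_n$ can be chosen so that, for every $n\ge K$, $$\|r_n\|=(n+1)^{-1/2+\beta},\qquad q_n=\langle r_{n-1},d_n\rangle,\qquad \|d_n\|=1,$$ and so that moreover there is $N_0\ge K$ (depending on $K$) such that for every integer $N\ge N_0$ there is $\epsilon_0\in(0,1]$ (depending on $N$ and $K$) such that for every $0<\epsilon<\epsilon_0$ the following holds. Put $$\tilde d_N=\epsilon\frac{r_N}{\|r_N\|}+\sqrt{1-\epsilon^2}\,d_N,\qquad \mathbb{D}=\{-\tilde d_N,\tilde d_N\}\cup\{-d_n,d_n\}_{n\ge N}.$$ Then $$|\langle r_{n-1},\tilde d_N\rangle|<q_n\quad\text{and}\quad|\langle r_{n-1},d_k\rangle|<q_n\qquad\text{for all } n>N,\ k\ge N,\ k\ne n.$$ Consequently $\mathbb{D}$ is a symmetric set of unit vectors,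 and $r_N,r_{N+1},\dots$ is a realization of the pure greedy algorithm with dictionary $\mathbb{D}$ and initial residual $f=r_N$: for every $n>N$, $d_n\in\mathbb{D}$ maximizes $\langle r_{n-1},d\rangle$ over $d\in\mathbb{D}$, and $r_n=r_{n-1}-\langle r_{n-1},d_n\rangle d_n$. -/

import Mathlib

open scoped ContDiff

namespace PureGreedy

/-- A dictionary: a symmetric collection of unit vectors. -/
def IsDictionary {E : Type*} [NormedAddCommGroup E] (D : Set E) : Prop :=
  (∀ g ∈ D, ‖g‖ = 1) ∧ ∀ g ∈ D, -g ∈ D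

/-- `(ρ, g)` is a realization of the pure greedy algorithm with dictionary `D` and initial
residual `f`: `ρ 0 = f`, and at step `m + 1` the element `g (m + 1)` of `D` maximizes
`⟪ρ m, ·⟫` over `D` and `ρ (m + 1) = ρ m - ⟪ρ m, g (m + 1)⟫ g (m + 1)`.
(The value `g 0` plays no role.) -/
def IsPureGreedyRun {E : Type*} [NormedAddCommGroup E] [InnerProductSpace ℝ E]
    (D : Set E) (f : E) (ρ g : ℕ → E) : Prop :=
  ρ 0 = f ∧ ∀ m : ℕ,
    g (m + 1) ∈ D ∧
    (∀ x ∈ D, inner ℝ (ρ m) x ≤ inner ℝ (ρ m) (g (m + 1))) ∧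
    ρ (m + 1) = ρ m - (inner ℝ (ρ m) (g (m + 1)) : ℝ) • g (m + 1)

/-- The real Hilbert space `ℓ²`. -/
abbrev ell2 : Type := lp (fun _ : ℕ => ℝ) 2

/-- The standard basis of `ℓ²`, enumerated as `e 1, e 2, e 3, …` (`e 0` is never used). -/
noncomputable def e (n : ℕ) : ell2 := lp.single 2 (n - 1) (1 : ℝ)

/-- `h_n = ∑_{i=1}^{n-1} (a / n) φ(i / n) e_i`, with `a` in the role of `α_n`. -/
noncomputable def h (φ : ℝ → ℝ) (a : ℝ) (n : ℕ) : ell2 :=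
  ∑ i ∈ Finset.Icc 1 (n - 1), (a / (n : ℝ) * φ ((i : ℝ) / (n : ℝ))) • e i

/-- The inductive definition of `r_n` (`n ≥ K - 1`) and `d_n` (`n ≥ K`) out of the numbers
`γ_n, ξ_n, α_n, q_n` (`n ≥ K`). Values at smaller indices play no role. -/
structure IsIteration (β : ℝ) (φ : ℝ → ℝ) (K : ℕ) (γ ξ α q : ℕ → ℝ) (r d : ℕ → ell2) :
    Prop where
  init : r (K - 1) =
    -(((K : ℝ) ^ (-1 / 2 + β : ℝ) * (1 / Real.sqrt ((K : ℝ) - 1))) •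
      ∑ i ∈ Finset.Icc 1 (K - 1), e i)
  direction : ∀ n ≥ K, d n = γ n • r (n - 1) + h φ (α n) n + ξ n • e n
  residual : ∀ n ≥ K, r n = r (n - 1) - q n • d n

/-- The three conditions imposed on the iteration at each index `n ≥ K`. -/
structure IsAdmissible (β : ℝ) (K : ℕ) (q : ℕ → ℝ) (r d : ℕ → ell2) : Prop where
  norm_residual : ∀ n ≥ K, ‖r n‖ = ((n : ℝ) + 1) ^ (-1 / 2 + β : ℝ)
  coeff : ∀ n ≥ K, q n = inner ℝ (r (n - 1)) (d n)
  norm_direction : ∀ n ≥ K, ‖d n‖ = 1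

/-- `d̃_N = ε r_N / ‖r_N‖ + √(1 - ε²) d_N`. -/
noncomputable def dTilde (r d : ℕ → ell2) (N : ℕ) (ε : ℝ) : ell2 :=
  (ε / ‖r N‖) • r N + Real.sqrt (1 - ε ^ 2) • d N

/-- The dictionary `{-d̃_N, d̃_N} ∪ {-d_n, d_n}_{n ≥ N}`. -/
def dictionary (r d : ℕ → ell2) (N : ℕ) (ε : ℝ) : Set ell2 :=
  {-dTilde r d N ε, dTilde r d N ε} ∪ {x | ∃ n ≥ N, x = -d n ∨ x = d n}

end PureGreedy

open PureGreedy

/-! The norm and coefficient requirements force `q_n² = n^(2β-1) - (n+1)^(2β-1)`. Write `-n^(1-β)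
r_{n-1} = ∑ U(n,i) e_i`, so that the norm condition reads `∑_{i<n} U(n,i)² = n`. Choose `γ_n` so
that the part of `q_n d_n` along `r_{n-1}` exactly offsets the change of normalization from `n` to
`n+1`. Old coordinates then only receive increments of size `b_n α_n φ(i/n)/n`, with `b_n =
(n+1)^(1-β) q_n`, and the new coordinate is `b_n ξ_n`. Hence `U(n,i)` is an explicit sum over `i < m
< n`, a discrete Volterra formula. The number `α_n` is fixed by `⟪r_{n-1}, d_n⟫ = q_n` and `ξ_n` by
`‖d_n‖ = 1`. An induction (`exists_forall_stepBounds`) shows that these choices are legitimate for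
large `K` and stay bounded.

Next `ξ_n → 1`, since `1 - ξ_n² = O(1/n)`, and `α_n → 1` by a contraction argument
(`tendsto_one_of_contraction`). The integral identity for `φ` is precisely what makes `1` the fixed
point. Consequently `U(n,i) ≈ s Φ(i/n)` with `s = √(1-2β)` and `Φ(x) = 1 + ∫_x^1 φ(z)/z dz`. The low
coordinates of `n d_n` approach `φ - (1-β)Φ`, and `n^(1-β) q_n → s`. Averages of products of such
arrays converge to integrals, uniformly in the ratio of the two indices (`IsProfile.avg_mul`).

For `k < n`, the rescaled product of `r_{n-1}` with `d_k` tends to `s` times the quantity in the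
second supremum condition at `a = k/n` (up to sign), so it is at most a fixed fraction of `q_n`
(`exists_abs_dirDot_le`). For `k > n` a direct limit would not do: at `k/n` near `1` the ratio to
`q_n` tends to `1`. Instead a backward induction on `n`, starting from the exact value at `n = k`,
is used (`exists_abs_dirDot_lt`). Its increment is controlled by the first supremum condition after
integration by parts, and it needs `n^(1-β) q_n` to be almost decreasing (`scaledCoeff_succ_le`).

Finally, the products of `r_{n-1}` with `d_N` are uniformly below `q_n` by a factor, and those with
`r_N` are `O(q_n)`. A small admixture of `r_N` in `d_N` is therefore harmless
(`exists_dictionary_run`). -/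

namespace PureGreedy

/-! ### Averages, Riemann sums and arrays with a limit profile -/

section
/-- The normalized sum `(1 / n) ∑_{1 ≤ i < n} f i`. -/
noncomputable def avg (n : ℕ) (f : ℕ → ℝ) : ℝ := (∑ i ∈ Finset.Ico 1 n, f i) / n

lemma avg_add (n : ℕ) (f g : ℕ → ℝ) :
    avg n (fun i => f i + g i) = avg n f + avg n g := by
  simp [avg, Finset.sum_add_distrib, add_div]

lemma avg_sub (n : ℕ) (f g : ℕ → ℝ) :
    avg n (fun i => f i - g i) = avg n f - avg n g := by
  simp [avg, Finset.sum_sub_distrib, sub_div]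

lemma avg_const_mul (n : ℕ) (c : ℝ) (f : ℕ → ℝ) :
    avg n (fun i => c * f i) = c * avg n f := by
  simp [avg, ← Finset.mul_sum, mul_div_assoc]

lemma avg_mono {n : ℕ} {f g : ℕ → ℝ} (h : ∀ i, 1 ≤ i → i < n → f i ≤ g i) :
    avg n f ≤ avg n g := by
  unfold avg
  gcongr with i hi
  exact h i (Finset.mem_Ico.1 hi).1 (Finset.mem_Ico.1 hi).2

/-- Finitely many exceptional columns, where only a crude bound is known, contribute `O(1/n)` to an
average. This is what lets asymptotics valid only for large `i` determine limits of averages. -/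
lemma avg_le {n M : ℕ} {w : ℕ → ℝ} {D η : ℝ} (hD : 0 ≤ D) (hη : 0 ≤ η)
    (h1 : ∀ i, 1 ≤ i → i < n → w i ≤ D) (h2 : ∀ i, 1 ≤ i → M ≤ i → i < n → w i ≤ η) :
    avg n w ≤ η + D * M / n := by
  rcases Nat.eq_zero_or_pos n with rfl | hn
  · simpa [avg] using hη
  have hn' : (0 : ℝ) < n := by exact_mod_cast hn
  have key : ∑ i ∈ Finset.Ico 1 n, w i ≤ n * η + D * M := by
    calc ∑ i ∈ Finset.Ico 1 n, w i
        ≤ ∑ i ∈ Finset.Ico 1 n, (η + if i < M then D else 0) := by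
          refine Finset.sum_le_sum fun i hi => ?_
          obtain ⟨hi1, hi2⟩ := Finset.mem_Ico.1 hi
          split_ifs with hM
          · linarith [h1 i hi1 hi2]
          · linarith [h2 i hi1 (not_lt.1 hM) hi2]
      _ ≤ ∑ i ∈ Finset.range n, η + ∑ i ∈ Finset.range M, D := by
          rw [Finset.sum_add_distrib, ← Finset.sum_filter]
          gcongr
          · intro i hi
            exact Finset.mem_range.2 (Finset.mem_Ico.1 hi).2
          · intro i hi
            exact Finset.mem_range.2 (Finset.mem_filter.1 hi).2
      _ = n * η + D * M := by simp; ring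
  rw [avg, div_le_iff₀ hn', add_mul, div_mul_cancel₀ _ hn'.ne']
  linarith

lemma abs_avg_le {n M : ℕ} {w : ℕ → ℝ} {D η : ℝ} (hD : 0 ≤ D) (hη : 0 ≤ η)
    (h1 : ∀ i, 1 ≤ i → i < n → |w i| ≤ D)
    (h2 : ∀ i, 1 ≤ i → M ≤ i → i < n → |w i| ≤ η) :
    |avg n w| ≤ η + D * M / n := by
  have hneg : avg n (fun i => - w i) = - avg n w := by
    simpa using avg_const_mul n (-1) w
  rw [abs_le']
  refine ⟨avg_le hD hη (fun i a b => (le_abs_self _).trans (h1 i a b))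
    (fun i a b c => (le_abs_self _).trans (h2 i a b c)), ?_⟩
  rw [← hneg]
  exact avg_le hD hη (fun i a b => (neg_le_abs _).trans (h1 i a b))
    (fun i a b c => (neg_le_abs _).trans (h2 i a b c))

/-- `f` is bounded by `C` and `C`-Lipschitz on the unit interval. -/
structure LipBdd (C : ℝ) (f : ℝ → ℝ) : Prop where
  bound : ∀ x ∈ Set.Icc (0 : ℝ) 1, |f x| ≤ C
  lip : ∀ x ∈ Set.Icc (0 : ℝ) 1, ∀ y ∈ Set.Icc (0 : ℝ) 1, |f x - f y| ≤ C * |x - y|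

namespace LipBdd

variable {C D : ℝ} {f g : ℝ → ℝ}

lemma nonneg (hf : LipBdd C f) : 0 ≤ C :=
  (abs_nonneg _).trans (hf.bound 0 (by simp))

lemma continuousOn (hf : LipBdd C f) : ContinuousOn f (Set.Icc 0 1) := by
  have : LipschitzOnWith ⟨C, hf.nonneg⟩ f (Set.Icc 0 1) :=
    LipschitzOnWith.of_dist_le_mul fun x hx y hy => by
      rw [Real.dist_eq, Real.dist_eq]; exact hf.lip x hx y hy
  exact this.continuousOn

lemma intervalIntegrable (hf : LipBdd C f) {x y : ℝ} (hx : x ∈ Set.Icc (0 : ℝ) 1)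
    (hy : y ∈ Set.Icc (0 : ℝ) 1) : IntervalIntegrable f MeasureTheory.volume x y :=
  (hf.continuousOn.mono (Set.uIcc_subset_Icc hx hy)).intervalIntegrable

/-- Contracting the argument does not increase the constant `C`, so Riemann sum errors are uniform
in `a`. -/
lemma comp_mul (hf : LipBdd C f) {a : ℝ} (ha : a ∈ Set.Icc (0 : ℝ) 1) :
    LipBdd C (fun x => f (a * x)) := by
  have hm : ∀ x ∈ Set.Icc (0 : ℝ) 1, a * x ∈ Set.Icc (0 : ℝ) 1 := fun x hx =>
    ⟨mul_nonneg ha.1 hx.1, mul_le_one₀ ha.2 hx.1 hx.2⟩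
  refine ⟨fun x hx => hf.bound _ (hm x hx), fun x hx y hy => ?_⟩
  refine (hf.lip _ (hm x hx) _ (hm y hy)).trans ?_
  have : |a * x - a * y| ≤ |x - y| := by
    rw [← mul_sub, abs_mul, abs_of_nonneg ha.1]
    exact mul_le_of_le_one_left (abs_nonneg _) ha.2
  exact mul_le_mul_of_nonneg_left this hf.nonneg

lemma mul (hf : LipBdd C f) (hg : LipBdd D g) : LipBdd (2 * C * D) (fun x => f x * g x) := by
  have hC := hf.nonneg
  have hD := hg.nonneg
  refine ⟨fun x hx => ?_, fun x hx y hy => ?_⟩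
  · rw [abs_mul]
    have := mul_le_mul (hf.bound x hx) (hg.bound x hx) (abs_nonneg _) hC
    nlinarith [mul_nonneg hC hD]
  · have e1 : f x * g x - f y * g y = f x * (g x - g y) + (f x - f y) * g y := by ring
    rw [e1]
    refine (abs_add_le _ _).trans ?_
    rw [abs_mul, abs_mul]
    have h1 := mul_le_mul (hf.bound x hx) (hg.lip x hx y hy) (abs_nonneg _) hC
    have h2 := mul_le_mul (hf.lip x hx y hy) (hg.bound y hy) (abs_nonneg _)
      (mul_nonneg hC (abs_nonneg _))
    calc _ ≤ C * (D * |x - y|) + C * |x - y| * D := add_le_add h1 h2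
      _ = _ := by ring

lemma const (c : ℝ) : LipBdd |c| (fun _ => c) :=
  ⟨fun _ _ => le_rfl, fun x _ y _ => by simpa using by positivity⟩

lemma add (hf : LipBdd C f) (hg : LipBdd D g) : LipBdd (C + D) (fun x => f x + g x) := by
  refine ⟨fun x hx => (abs_add_le _ _).trans (add_le_add (hf.bound x hx) (hg.bound x hx)),
    fun x hx y hy => ?_⟩
  have e1 : f x + g x - (f y + g y) = (f x - f y) + (g x - g y) := by ring
  rw [e1, add_mul]
  exact (abs_add_le _ _).trans (add_le_add (hf.lip x hx y hy) (hg.lip x hx y hy))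

lemma abs_integral_sub_le (hf : LipBdd C f) {x y t : ℝ} (hx : x ∈ Set.Icc (0 : ℝ) 1)
    (hy : y ∈ Set.Icc (0 : ℝ) 1) (hxy : x ≤ y) (ht : t ∈ Set.Icc x y) :
    |(∫ z in x..y, f z) - (y - x) * f t| ≤ C * (y - x) * (y - x) := by
  have e1 : (y - x) * f t = ∫ _z in x..y, f t := by simp
  rw [e1, ← intervalIntegral.integral_sub (hf.intervalIntegrable hx hy) (by simp)]
  have := intervalIntegral.norm_integral_le_of_norm_le_const (a := x) (b := y)
    (f := fun z => f z - f t) (C := C * (y - x)) (fun z hz => by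
      rw [Set.uIoc_of_le hxy] at hz
      refine (hf.lip z ⟨hx.1.trans hz.1.le, hz.2.trans hy.2⟩ t
        ⟨hx.1.trans ht.1, ht.2.trans hy.2⟩).trans ?_
      refine mul_le_mul_of_nonneg_left ?_ hf.nonneg
      rw [abs_le]
      constructor <;> linarith [hz.1, hz.2, ht.1, ht.2])
  rwa [abs_of_nonneg (sub_nonneg.2 hxy)] at this

/-- Each cell of length `1/n` costs `C/n²`. The second `C/n` pays for the term `i = 0`, which `avg`
omits. -/
lemma abs_avg_sub_integral_le (hf : LipBdd C f) {n : ℕ} (hn : 0 < n) :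
    |avg n (fun i => f (i / n)) - ∫ x in (0 : ℝ)..1, f x| ≤ 2 * C / n := by
  have hn' : (0 : ℝ) < n := by exact_mod_cast hn
  have hmem : ∀ i : ℕ, i ≤ n → (i : ℝ) / n ∈ Set.Icc (0 : ℝ) 1 := fun i hi =>
    ⟨by positivity, (div_le_one hn').2 (by exact_mod_cast hi)⟩
  have hsum : ∫ x in (0 : ℝ)..1, f x
      = ∑ i ∈ Finset.range n, ∫ x in ((i : ℝ) / n)..(((i + 1 : ℕ) : ℝ) / n), f x := by
    rw [intervalIntegral.sum_integral_adjacent_intervals (a := fun i : ℕ => (i : ℝ) / n)]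
    · simp [hn'.ne']
    · intro k hk
      exact hf.intervalIntegrable (hmem k hk.le) (hmem (k + 1) hk)
  have havg : avg n (fun i => f (i / n))
      = (∑ i ∈ Finset.range n, (1 / n : ℝ) * f (i / n)) - f 0 / n := by
    rw [avg, Finset.range_eq_Ico, Finset.sum_eq_sum_Ico_succ_bot hn, ← Finset.mul_sum]
    simp; ring
  have hterm : ∀ i ∈ Finset.range n,
      |(1 / n : ℝ) * f (i / n) - ∫ x in ((i : ℝ) / n)..(((i + 1 : ℕ) : ℝ) / n), f x|
        ≤ C * (1 / n) * (1 / n) := by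
    intro i hi
    have hi := Finset.mem_range.1 hi
    have e1 : (((i + 1 : ℕ) : ℝ) / n) - (i : ℝ) / n = 1 / n := by push_cast; ring
    have hle : (i : ℝ) / n ≤ ((i + 1 : ℕ) : ℝ) / n := by
      have : (0 : ℝ) < 1 / n := by positivity
      linarith
    have := hf.abs_integral_sub_le (hmem i hi.le) (hmem (i + 1) hi) hle
      (t := (i : ℝ) / n) ⟨le_rfl, hle⟩
    rw [e1] at this
    rwa [abs_sub_comm]
  have h0 : |f 0 / n| ≤ C / n := by
    rw [abs_div, abs_of_pos hn']
    gcongr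
    exact hf.bound 0 (by simp)
  rw [havg, hsum]
  have e2 : ∀ A B c : ℝ, A - c - B = (A - B) - c := by intros; ring
  rw [e2, ← Finset.sum_sub_distrib]
  refine (abs_sub _ _).trans ?_
  have h1 := (Finset.abs_sum_le_sum_abs _ _).trans (Finset.sum_le_sum hterm)
  have h2 : ∑ _i ∈ Finset.range n, C * (1 / n : ℝ) * (1 / n) = C / n := by
    simp; field_simp
  rw [h2] at h1
  have : 2 * C / n = C / n + C / n := by ring
  linarith

end LipBdd

/-- The array `X` is bounded and `X n i` is close to `f (i / n)` when `i` is large. -/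
structure IsProfile (X : ℕ → ℕ → ℝ) (f : ℝ → ℝ) : Prop where
  lipBdd : ∃ C, LipBdd C f
  bdd : ∃ B, ∀ n i, 1 ≤ i → i < n → |X n i| ≤ B
  conv : ∀ ε > 0, ∃ M : ℕ, ∀ i ≥ M, ∀ n > i, |X n i - f (i / n)| ≤ ε

lemma div_mem_unit {i n : ℕ} (h : i ≤ n) : (i : ℝ) / n ∈ Set.Icc (0 : ℝ) 1 :=
  ⟨by positivity, div_le_one_of_le₀ (by exact_mod_cast h) (by positivity)⟩

lemma IsProfile.of_lipBdd {C : ℝ} {f : ℝ → ℝ} (hf : LipBdd C f) :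
    IsProfile (fun n i => f (i / n)) f :=
  ⟨⟨C, hf⟩, ⟨C, fun _ _ _ hi => hf.bound _ (div_mem_unit hi.le)⟩,
    fun ε hε => ⟨0, fun i _ n _ => by simpa using hε.le⟩⟩

/-- The uniformity in `p ≥ n` is the point: the two index ranges of an inner product may have any
ratio `n/p` in `(0,1]`, and one threshold for `n` serves them all. -/
theorem IsProfile.avg_mul {X Y : ℕ → ℕ → ℝ} {f g : ℝ → ℝ} (hX : IsProfile X f)
    (hY : IsProfile Y g) {ε : ℝ} (hε : 0 < ε) :
    ∃ N : ℕ, ∀ n ≥ N, ∀ p ≥ n,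
      |avg n (fun i => X n i * Y p i) - ∫ x in (0 : ℝ)..1, f x * g ((n : ℝ) / p * x)| ≤ ε := by
  obtain ⟨C, hC⟩ := hX.lipBdd
  obtain ⟨D, hD⟩ := hY.lipBdd
  obtain ⟨B', hB'⟩ := hX.bdd
  obtain ⟨E', hE'⟩ := hY.bdd
  set B := |B'|
  set E := |E'|
  have hB : ∀ n i, 1 ≤ i → i < n → |X n i| ≤ B := fun n i a b =>
    (hB' n i a b).trans (le_abs_self _)
  have hE : ∀ n i, 1 ≤ i → i < n → |Y n i| ≤ E := fun n i a b =>
    (hE' n i a b).trans (le_abs_self _)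
  have hC0 := hC.nonneg
  have hD0 := hD.nonneg
  have hB0 : 0 ≤ B := abs_nonneg _
  have hE0 : 0 ≤ E := abs_nonneg _
  set η := ε / (3 * (B + D + 1)) with hη
  have hη0 : 0 < η := by positivity
  obtain ⟨M1, hM1⟩ := hX.conv η hη0
  obtain ⟨M2, hM2⟩ := hY.conv η hη0
  set M := max M1 M2
  -- The crude bound on the error in the first `M` columns.
  set Q := B * E + C * D
  have hQ0 : 0 ≤ Q := by positivity
  obtain ⟨N, hN⟩ := exists_nat_gt ((Q * M + 4 * C * D) * 3 / ε + 1)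
  refine ⟨N, fun n hn p hp => ?_⟩
  have hnN : ((Q * M + 4 * C * D) * 3 / ε + 1) < n := hN.trans_le (by exact_mod_cast hn)
  have hn1 : (0 : ℝ) < n := by
    have : 0 ≤ (Q * M + 4 * C * D) * 3 / ε := by positivity
    linarith
  have hn0 : 0 < n := by exact_mod_cast hn1
  have hp1 : (0 : ℝ) < p := by exact_mod_cast hn0.trans_le hp
  have hpi : ∀ i : ℕ, (n : ℝ) / p * ((i : ℝ) / n) = i / p := fun i => by field_simp
  have hQn : (Q * M + 4 * C * D) / n ≤ ε / 3 := by
    rw [div_le_iff₀ hn1]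
    have h3 : (Q * M + 4 * C * D) * 3 / ε < n := by linarith
    rw [div_lt_iff₀ hε] at h3
    linarith
  have h1 := (hC.mul (hD.comp_mul (div_mem_unit hp))).abs_avg_sub_integral_le hn0
  simp only [hpi] at h1
  have h2 : |avg n (fun i => X n i * Y p i - f (i / n) * g (i / p))|
      ≤ η * (B + D) + Q * M / n := by
    refine abs_avg_le hQ0 (by positivity) (fun i i1 i2 => ?_) (fun i i1 iM i2 => ?_)
    · refine (abs_sub _ _).trans ?_
      rw [abs_mul, abs_mul]
      exact add_le_add
        (mul_le_mul (hB n i i1 i2) (hE p i i1 (i2.trans_le hp)) (abs_nonneg _) hB0)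
        (mul_le_mul (hC.bound _ (div_mem_unit i2.le))
          (hD.bound _ (div_mem_unit (i2.le.trans hp))) (abs_nonneg _) hC0)
    · have e1 : X n i * Y p i - f (i / n) * g (i / p)
          = X n i * (Y p i - g (i / p)) + (X n i - f (i / n)) * g (i / p) := by ring
      rw [e1]
      refine (abs_add_le _ _).trans ?_
      rw [abs_mul, abs_mul]
      have a1 := mul_le_mul (hB n i i1 i2)
        (hM2 i ((le_max_right _ _).trans iM) p (i2.trans_le hp)) (abs_nonneg _) hB0
      have a2 := mul_le_mul (hM1 i ((le_max_left _ _).trans iM) n i2)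
        (hD.bound _ (div_mem_unit (i2.le.trans hp))) (abs_nonneg _) hη0.le
      linarith
  rw [avg_sub] at h2
  have h3 : η * (B + D) ≤ ε / 3 := by
    rw [hη, div_mul_eq_mul_div, div_le_div_iff₀ (by positivity) (by norm_num)]
    nlinarith
  have h4 := abs_add_le
    (avg n (fun i => X n i * Y p i) - avg n (fun i => f (i / n) * g (i / p)))
    (avg n (fun i => f (i / n) * g (i / p)) - ∫ x in (0 : ℝ)..1, f x * g ((n : ℝ) / p * x))
  rw [sub_add_sub_cancel] at h4
  have h5 : Q * M / n + 2 * (2 * C * D) / n = (Q * M + 4 * C * D) / n := by ring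
  linarith

end

/-! ### The limit profile and its discretization -/

section
/-- `φ` is nonnegative, bounded, Lipschitz on the unit interval and vanishes on `[0, δ]`. -/
structure IsCutoff (φ : ℝ → ℝ) (δ B : ℝ) : Prop where
  pos : 0 < δ
  lt_one : δ < 1
  nonneg : ∀ x ∈ Set.Icc (0 : ℝ) 1, 0 ≤ φ x
  zero : ∀ x ∈ Set.Icc (0 : ℝ) δ, φ x = 0
  lipBdd : LipBdd B φ

/-- The limit profile `Φ(x) = 1 + ∫_x^1 φ(z) / z dz`. -/
noncomputable def profile (φ : ℝ → ℝ) (x : ℝ) : ℝ := 1 + ∫ z in x..1, φ z / z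

/-- The sum `∑_{i < m < n} φ(i / m) / m`, a discretization of `∫_{i/n}^1 φ(z) / z dz`. -/
noncomputable def logSum (φ : ℝ → ℝ) (n i : ℕ) : ℝ :=
  ∑ m ∈ Finset.Ico (i + 1) n, φ (i / m) / m

namespace IsCutoff

variable {φ : ℝ → ℝ} {δ B : ℝ}

/-- Since `φ` vanishes on `[0, δ]`, the denominator `x` may be replaced by `max x δ`, which is
bounded away from `0` and `1`-Lipschitz. -/
lemma lipBdd_div (hφ : IsCutoff φ δ B) : LipBdd (B / δ + B / δ ^ 2) (fun z => φ z / z) := by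
  have hδ := hφ.pos
  have hB := hφ.lipBdd.nonneg
  have key : ∀ x ∈ Set.Icc (0 : ℝ) 1, φ x / x = φ x / max x δ := by
    intro x hx
    rcases le_total x δ with h | h
    · simp [hφ.zero x ⟨hx.1, h⟩]
    · rw [max_eq_left h]
  have hm : ∀ x, 0 < max x δ := fun x => lt_max_of_lt_right hδ
  have hm' : ∀ x, δ ≤ max x δ := fun x => le_max_right _ _
  refine ⟨fun x hx => ?_, fun x hx y hy => ?_⟩
  · rw [key x hx, abs_div, abs_of_pos (hm x)]
    have : |φ x| / max x δ ≤ B / δ := by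
      gcongr
      · exact hφ.lipBdd.bound x hx
      · exact hm' x
    have : 0 ≤ B / δ ^ 2 := by positivity
    linarith
  · simp only [key x hx, key y hy]
    have e1 : φ x / max x δ - φ y / max y δ
        = (φ x - φ y) / max x δ + φ y * (max y δ - max x δ) / (max x δ * max y δ) := by
      have := (hm x).ne'
      have := (hm y).ne'
      field_simp
      ring
    rw [e1, add_mul]
    refine (abs_add_le _ _).trans (add_le_add ?_ ?_)
    · rw [abs_div, abs_of_pos (hm x), div_mul_eq_mul_div]
      gcongr
      · exact hφ.lipBdd.lip x hx y hy
      · exact hm' x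
    · have h1 : |max y δ - max x δ| ≤ |x - y| := by
        rw [abs_sub_comm x y]
        exact abs_max_sub_max_le_abs _ _ _
      have h2 : δ ^ 2 ≤ max x δ * max y δ := by
        rw [sq]
        exact mul_le_mul (hm' x) (hm' y) hδ.le (hm x).le
      rw [abs_div, abs_mul, abs_of_pos (mul_pos (hm x) (hm y)), div_mul_eq_mul_div]
      exact div_le_div₀ (by positivity)
        (mul_le_mul (hφ.lipBdd.bound y hy) h1 (abs_nonneg _) hB) (by positivity) h2

lemma profile_sub (hφ : IsCutoff φ δ B) {x y : ℝ} (hx : x ∈ Set.Icc (0 : ℝ) 1)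
    (hy : y ∈ Set.Icc (0 : ℝ) 1) : profile φ x - profile φ y = ∫ z in x..y, φ z / z := by
  unfold profile
  have h1 : (1 : ℝ) ∈ Set.Icc (0 : ℝ) 1 := by simp
  rw [← intervalIntegral.integral_add_adjacent_intervals
    (hφ.lipBdd_div.intervalIntegrable hx hy) (hφ.lipBdd_div.intervalIntegrable hy h1)]
  ring

lemma lipBdd_profile (hφ : IsCutoff φ δ B) :
    LipBdd (1 + (B / δ + B / δ ^ 2)) (profile φ) := by
  have hψ := hφ.lipBdd_div
  have hψ0 := hψ.nonneg
  have key : ∀ x ∈ Set.Icc (0 : ℝ) 1, ∀ y ∈ Set.Icc (0 : ℝ) 1,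
      |profile φ x - profile φ y| ≤ (B / δ + B / δ ^ 2) * |x - y| := by
    intro x hx y hy
    rw [hφ.profile_sub hx hy, abs_sub_comm x y]
    exact intervalIntegral.norm_integral_le_of_norm_le_const (f := fun z => φ z / z)
      fun z hz => hψ.bound z (Set.uIcc_subset_Icc hx hy (Set.uIoc_subset_uIcc hz))
  refine ⟨fun x hx => ?_, fun x hx y hy => (key x hx y hy).trans ?_⟩
  · have h1 := key x hx 1 (by simp)
    have h2 : profile φ 1 = 1 := by simp [profile]
    rw [h2] at h1
    have h3 : |x - 1| ≤ 1 := by rw [abs_le]; constructor <;> linarith [hx.1, hx.2]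
    have h4 := abs_add_le (profile φ x - 1) 1
    rw [sub_add_cancel, abs_one] at h4
    have := mul_le_mul_of_nonneg_left h3 hψ0
    linarith
  · exact mul_le_mul_of_nonneg_right (by linarith) (abs_nonneg _)

lemma profile_one_le (hφ : IsCutoff φ δ B) {x : ℝ} (hx : x ∈ Set.Icc (0 : ℝ) 1) :
    1 ≤ profile φ x := by
  have : 0 ≤ ∫ z in x..1, φ z / z :=
    intervalIntegral.integral_nonneg hx.2 fun z hz =>
      div_nonneg (hφ.nonneg z ⟨hx.1.trans hz.1, hz.2⟩) (hx.1.trans hz.1)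
  unfold profile; linarith

lemma hasDerivAt_profile (hφ : IsCutoff φ δ B) {x : ℝ} (hx : x ∈ Set.Ioo (0 : ℝ) 1) :
    HasDerivAt (profile φ) (-(φ x / x)) x := by
  have hx' : x ∈ Set.Icc (0 : ℝ) 1 := ⟨hx.1.le, hx.2.le⟩
  have hc := hφ.lipBdd_div.continuousOn
  have hnhds : Set.Icc (0 : ℝ) 1 ∈ nhds x := Icc_mem_nhds hx.1 hx.2
  have hca : ContinuousAt (fun z => φ z / z) x := hc.continuousAt hnhds
  have hmeas : StronglyMeasurableAtFilter (fun z => φ z / z) (nhds x) MeasureTheory.volume :=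
    (hc.mono Set.Ioo_subset_Icc_self).stronglyMeasurableAtFilter isOpen_Ioo x hx
  exact (intervalIntegral.integral_hasDerivAt_left
    (hφ.lipBdd_div.intervalIntegrable hx' (by simp)) hmeas hca).const_add 1

/-- The points `z = i/m` partition `[i/n, 1]`, and the cell from `i/(m+1)` to `i/m` has length
`i(1/m - 1/(m+1))`, so the term `φ(i/m)/m` nearly equals the integral of `φ(z)/z` over it. The cell
errors are bounded by multiples of `1/m - 1/(m+1)` and telescope to `O(1/i)`, uniformly in `n`. -/
lemma abs_logSum_sub_le (hφ : IsCutoff φ δ B) {i n : ℕ} (hi : 0 < i) (hn : i < n) :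
    |logSum φ n i - (profile φ (i / n) - 1)| ≤ (3 * B + B / δ + B / δ ^ 2) / i := by
  set Q := B / δ + B / δ ^ 2 with hQ
  have hψ := hφ.lipBdd_div
  have hB := hφ.lipBdd.nonneg
  have hQ0 : 0 ≤ Q := hψ.nonneg
  have hi' : (0 : ℝ) < i := by exact_mod_cast hi
  -- The sum is started at `m = i` so that at `n = i` both the difference and the bound vanish. The
  -- extra term, of size at most `B/i`, is removed afterwards.
  have key : ∀ n : ℕ, i ≤ n →
      |(∑ m ∈ Finset.Ico i n, φ (i / m) / m) - (profile φ (i / n) - 1)|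
        ≤ (B + Q) * (1 / i - 1 / n) := by
    intro n hn
    induction n, hn using Nat.le_induction with
    | base => simp [profile, hi'.ne']
    | succ n hn ih =>
      have hn0 : (0 : ℝ) < n := hi'.trans_le (by exact_mod_cast hn)
      have hmem := div_mem_unit hn
      have hmem' : (i : ℝ) / (n + 1 : ℕ) ∈ Set.Icc (0 : ℝ) 1 := div_mem_unit (by omega)
      have hle : (i : ℝ) / (n + 1 : ℕ) ≤ i / n := by
        push_cast
        gcongr
        linarith
      have h1 := hφ.profile_sub hmem' hmem
      have h2 := hψ.abs_integral_sub_le hmem' hmem hle (t := (i : ℝ) / n) ⟨hle, le_rfl⟩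
      have hd : (i : ℝ) / n - i / (n + 1 : ℕ) = i * (1 / n - 1 / (n + 1 : ℕ)) := by ring
      have hd2 : (1 : ℝ) / n - 1 / (n + 1 : ℕ) = 1 / (n * (n + 1)) := by
        push_cast
        field_simp
        ring
      set D : ℝ := 1 / n - 1 / (n + 1 : ℕ) with hD
      have hD0 : 0 ≤ D := by rw [hd2]; positivity
      -- The squared cell length is dominated by a telescoping quantity because `i ≤ n`.
      have hiD : (i * D) * (i * D) ≤ D := by
        have hin : (i : ℝ) ≤ n := by exact_mod_cast hn
        have a1 : (i : ℝ) * D ≤ 1 / (n + 1) := by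
          rw [hd2, mul_one_div, div_le_div_iff₀ (by positivity) (by positivity)]
          nlinarith
        have a2 : (1 : ℝ) / (n + 1) * (1 / (n + 1)) ≤ D := by
          rw [hd2, div_mul_div_comm, div_le_div_iff₀ (by positivity) (by positivity)]
          nlinarith
        exact (mul_le_mul a1 a1 (by positivity) (by positivity)).trans a2
      have h3 : |φ (i / n) / n - i * D * (φ (i / n) / (i / n))| ≤ B * D := by
        have e0 : φ (i / n) / n - i * D * (φ (i / n) / (i / n)) = φ (i / n) * D := by
          rw [hd2]
          field_simp
          ring
        rw [e0, abs_mul, abs_of_nonneg hD0]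
        exact mul_le_mul_of_nonneg_right (hφ.lipBdd.bound _ hmem) hD0
      rw [Finset.sum_Ico_succ_top hn]
      rw [hd] at h2
      have e2 : (∑ m ∈ Finset.Ico i n, φ (i / m) / m) + φ (i / n) / n
            - (profile φ (i / (n + 1 : ℕ)) - 1)
          = ((∑ m ∈ Finset.Ico i n, φ (i / m) / m) - (profile φ (i / n) - 1))
            + (φ (i / n) / n - i * D * (φ (i / n) / (i / n)))
            - ((∫ z in ((i : ℝ) / (n + 1 : ℕ))..(i / n), φ z / z)
              - i * D * (φ (i / n) / (i / n))) := by
        rw [← h1]; ring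
      rw [e2]
      refine (abs_sub _ _).trans ?_
      have h4 := abs_add_le ((∑ m ∈ Finset.Ico i n, φ (i / m) / m) - (profile φ (i / n) - 1))
        (φ (i / n) / n - i * D * (φ (i / n) / (i / n)))
      have h5 : Q * (i * D) * (i * D) ≤ Q * D := by
        rw [mul_assoc]; exact mul_le_mul_of_nonneg_left hiD hQ0
      have e3 : (B + Q) * (1 / i - 1 / (n + 1 : ℕ))
          = (B + Q) * (1 / i - 1 / n) + (B * D + Q * D) := by rw [hD]; ring
      rw [e3]
      linarith
  have h1 := key n hn.le
  rw [Finset.sum_eq_sum_Ico_succ_bot hn] at h1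
  have h2 : |φ (i / i) / i| ≤ B / i := by
    rw [abs_div, abs_of_pos hi']
    gcongr
    exact hφ.lipBdd.bound _ (div_mem_unit le_rfl)
  have e1 : logSum φ n i - (profile φ (i / n) - 1)
      = (φ (i / i) / i + ∑ m ∈ Finset.Ico (i + 1) n, φ (i / m) / m - (profile φ (i / n) - 1))
        - φ (i / i) / i := by
    unfold logSum; ring
  rw [e1]
  refine (abs_sub _ _).trans ?_
  have h3 : (B + Q) * (1 / i - 1 / (n : ℝ)) ≤ (B + Q) / i := by
    rw [mul_sub, mul_one_div]
    have : 0 ≤ (B + Q) * (1 / (n : ℝ)) := by positivity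
    linarith
  have h4 : (3 * B + B / δ + B / δ ^ 2) / i = (B + Q) / i + B / i + B / i := by
    rw [hQ]; ring
  have : 0 ≤ B / i := by positivity
  linarith

lemma logSum_nonneg (hφ : IsCutoff φ δ B) (n i : ℕ) : 0 ≤ logSum φ n i :=
  Finset.sum_nonneg fun m hm =>
    div_nonneg (hφ.nonneg _ (div_mem_unit (by have := Finset.mem_Ico.1 hm; omega))) (by positivity)

lemma isProfile_logSum (hφ : IsCutoff φ δ B) :
    IsProfile (logSum φ) (fun x => profile φ x + -1) := by
  have hB := hφ.lipBdd.nonneg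
  have hδ := hφ.pos
  have hlip := hφ.lipBdd_profile.add (LipBdd.const (-1))
  set Q := 3 * B + B / δ + B / δ ^ 2 with hQ
  have hQ0 : 0 ≤ Q := by positivity
  refine ⟨⟨_, hlip⟩, ⟨Q + (1 + (B / δ + B / δ ^ 2) + |(-1 : ℝ)|), fun n i hi hin => ?_⟩,
    fun ε hε => ?_⟩
  · have h1 := hφ.abs_logSum_sub_le hi hin
    have h2 : Q / i ≤ Q := div_le_self hQ0 (by exact_mod_cast hi)
    have h3 := hlip.bound _ (div_mem_unit hin.le)
    have h4 := abs_add_le (logSum φ n i - (profile φ (i / n) - 1)) (profile φ (i / n) + -1)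
    rw [show logSum φ n i - (profile φ (i / n) - 1) + (profile φ (i / n) + -1)
      = logSum φ n i by ring] at h4
    linarith
  · obtain ⟨M, hM⟩ := exists_nat_gt (Q / ε)
    refine ⟨M + 1, fun i hi n hn => ?_⟩
    have hi0 : 0 < i := by omega
    have hi' : (0 : ℝ) < i := by exact_mod_cast hi0
    refine (le_of_eq ?_).trans ((hφ.abs_logSum_sub_le hi0 hn).trans ?_)
    · congr 1
    · rw [div_le_iff₀ hi']
      rw [div_lt_iff₀ hε] at hM
      have : (M : ℝ) ≤ i := by exact_mod_cast (by omega : M ≤ i)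
      nlinarith

end IsCutoff

end

/-! ### Integration by parts for the hypotheses on `φ` -/

section
namespace IsCutoff

variable {φ : ℝ → ℝ} {δ B : ℝ}

/-- Integrate the derivative `Φ² - 2φΦ` of `xΦ(x)²`, using `Φ' = -φ/x` and `Φ(1) = 1`. -/
lemma integral_profile_mul_profile (hφ : IsCutoff φ δ B) :
    ∫ x in (0 : ℝ)..1, profile φ x * profile φ x
      = 1 + 2 * ∫ x in (0 : ℝ)..1, φ x * profile φ x := by
  have h0 : (0 : ℝ) ∈ Set.Icc (0 : ℝ) 1 := by simp
  have h1 : (1 : ℝ) ∈ Set.Icc (0 : ℝ) 1 := by simp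
  have hΦ := hφ.lipBdd_profile
  have i1 := (hΦ.mul hΦ).intervalIntegrable h0 h1
  have i2 := ((hφ.lipBdd.mul hΦ).intervalIntegrable h0 h1).const_mul 2
  have key := intervalIntegral.integral_eq_sub_of_hasDerivAt_of_le (a := 0) (b := 1)
    (f := fun x => x * (profile φ x * profile φ x))
    (f' := fun x => profile φ x * profile φ x - 2 * (φ x * profile φ x)) zero_le_one
    (continuousOn_id.mul (hΦ.mul hΦ).continuousOn) (fun x hx => by
      have hd := hφ.hasDerivAt_profile hx
      refine ((hasDerivAt_id x).mul (hd.mul hd)).congr_deriv ?_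
      have : x ≠ 0 := hx.1.ne'
      simp only [id, Pi.mul_apply]
      field_simp
      ring) (i1.sub i2)
  rw [intervalIntegral.integral_sub i1 i2, intervalIntegral.integral_const_mul] at key
  have h2 : profile φ 1 = 1 := by simp [profile]
  simp only [h2] at key
  linarith

/-- Integration by parts for the first supremum condition. -/
lemma integral_first_condition (hφ : IsCutoff φ δ B) {φ' : ℝ → ℝ}
    (hd : ∀ x ∈ Set.Ioo (0 : ℝ) 1, HasDerivAt φ (φ' x) x)
    (hc : ContinuousOn φ' (Set.Icc 0 1)) (β : ℝ) {a : ℝ} (ha0 : 0 < a) (ha1 : a ≤ 1) :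
    ∫ x in (0 : ℝ)..a, (φ' x * x - (β - 1) * φ x) * profile φ (a⁻¹ * x)
      = a * ((1 - β) * (∫ x in (0 : ℝ)..1, profile φ x * profile φ (a * x))
            - ∫ x in (0 : ℝ)..1, profile φ x * φ (a * x))
        + a * (φ a - (1 - β) * profile φ a
            + (∫ x in (0 : ℝ)..1, φ x * φ (a * x))
            - (1 - β) * ∫ x in (0 : ℝ)..1, φ x * profile φ (a * x)) := by
  have h0 : (0 : ℝ) ∈ Set.Icc (0 : ℝ) 1 := by simp
  have h1 : (1 : ℝ) ∈ Set.Icc (0 : ℝ) 1 := by simp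
  have ha : a ∈ Set.Icc (0 : ℝ) 1 := ⟨ha0.le, ha1⟩
  have hΦ := hφ.lipBdd_profile
  have hΦa := hΦ.comp_mul ha
  have hφa := hφ.lipBdd.comp_mul ha
  have hm : Set.MapsTo (fun x : ℝ => a * x) (Set.Icc 0 1) (Set.Icc 0 1) := fun x hx =>
    ⟨mul_nonneg ha0.le hx.1, mul_le_one₀ ha1 hx.1 hx.2⟩
  have hca : ContinuousOn (fun x => φ' (a * x)) (Set.Icc 0 1) :=
    hc.comp (by fun_prop) hm
  have hlin : ContinuousOn (fun x : ℝ => a * x) (Set.Icc 0 1) := by fun_prop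
  have i1 := (hΦ.mul hΦa).intervalIntegrable h0 h1
  have i2 := (hΦ.mul hφa).intervalIntegrable h0 h1
  have i3 := (hφ.lipBdd.mul hφa).intervalIntegrable h0 h1
  have i4 := (hφ.lipBdd.mul hΦa).intervalIntegrable h0 h1
  have cI : ContinuousOn
      (fun x => (φ' (a * x) * (a * x) - (β - 1) * φ (a * x)) * profile φ x) (Set.Icc 0 1) :=
    ((hca.mul hlin).sub (continuousOn_const.mul hφa.continuousOn)).mul hΦ.continuousOn
  have i5 : IntervalIntegrable
      (fun x => (φ' (a * x) * (a * x) - (β - 1) * φ (a * x)) * profile φ x)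
      MeasureTheory.volume 0 1 :=
    (cI.mono (Set.uIcc_subset_Icc h0 h1)).intervalIntegrable
  have hsub : ∫ x in (0 : ℝ)..a, (φ' x * x - (β - 1) * φ x) * profile φ (a⁻¹ * x)
      = a * ∫ x in (0 : ℝ)..1,
          (φ' (a * x) * (a * x) - (β - 1) * φ (a * x)) * profile φ x := by
    have := intervalIntegral.integral_comp_mul_left (a := 0) (b := 1)
      (fun x => (φ' x * x - (β - 1) * φ x) * profile φ (a⁻¹ * x)) ha0.ne'
    simp only [inv_mul_cancel_left₀ ha0.ne', mul_zero, mul_one, smul_eq_mul] at this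
    rw [this, mul_inv_cancel_left₀ ha0.ne']
  -- With `D = φ - (1-β)Φ`, the identity comes from differentiating `x D(ax) Φ(x)`. The boundary
  -- term at `1` is `D(a)`, and the factor `φ'(ax)·ax - (β-1)φ(ax)` is exactly `x` times the
  -- derivative of `D(ax)`.
  have key := intervalIntegral.integral_eq_sub_of_hasDerivAt_of_le (a := 0) (b := 1)
    (f := fun x => x * ((φ (a * x) - (1 - β) * profile φ (a * x)) * profile φ x))
    (f' := fun x => (profile φ x * φ (a * x) - (1 - β) * (profile φ x * profile φ (a * x)))
      + (φ' (a * x) * (a * x) - (β - 1) * φ (a * x)) * profile φ x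
      - (φ x * φ (a * x) - (1 - β) * (φ x * profile φ (a * x)))) zero_le_one
    (continuousOn_id.mul ((hφa.continuousOn.sub
      (continuousOn_const.mul hΦa.continuousOn)).mul hΦ.continuousOn)) (fun x hx => by
      have hax : a * x ∈ Set.Ioo (0 : ℝ) 1 :=
        ⟨mul_pos ha0 hx.1, (mul_le_of_le_one_left hx.1.le ha1).trans_lt hx.2⟩
      have d0 := hφ.hasDerivAt_profile hx
      have dl : HasDerivAt (fun x : ℝ => a * x) a x := by
        simpa using (hasDerivAt_id x).const_mul a
      have d1 := (hφ.hasDerivAt_profile hax).comp x dl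
      have d2 := (hd _ hax).comp x dl
      refine ((hasDerivAt_id x).mul ((d2.sub (d1.const_mul (1 - β))).mul d0)).congr_deriv ?_
      have : x ≠ 0 := hx.1.ne'
      have := ha0.ne'
      simp only [id, Function.comp, Pi.mul_apply, Pi.sub_apply]
      field_simp
      ring) (((i2.sub (i1.const_mul _)).add i5).sub (i3.sub (i4.const_mul _)))
  rw [intervalIntegral.integral_sub ((i2.sub (i1.const_mul _)).add i5) (i3.sub (i4.const_mul _)),
    intervalIntegral.integral_add (i2.sub (i1.const_mul _)) i5,
    intervalIntegral.integral_sub i2 (i1.const_mul _),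
    intervalIntegral.integral_sub i3 (i4.const_mul _),
    intervalIntegral.integral_const_mul, intervalIntegral.integral_const_mul] at key
  have h2 : profile φ 1 = 1 := by simp [profile]
  simp only [h2, mul_one, one_mul, zero_mul, sub_zero] at key
  rw [hsub, ← mul_add]
  congr 1
  linarith

/-- The second supremum condition in terms of the limit profile. -/
lemma integral_second_condition (hφ : IsCutoff φ δ B) (β : ℝ) {a : ℝ}
    (ha : a ∈ Set.Icc (0 : ℝ) 1) :
    (∫ x in (0 : ℝ)..1,
          ((β - 1) + (β - 1) * (∫ z in x..1, φ z / z) + φ x) *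
            (∫ z in (a * x)..x, φ z / z)) + ∫ x in a..1, φ x / x
      = (1 - β) * (∫ x in (0 : ℝ)..1, profile φ x * profile φ x)
        - (∫ x in (0 : ℝ)..1, φ x * profile φ x) - 1
        - ((1 - β) * (∫ x in (0 : ℝ)..1, profile φ x * profile φ (a * x))
            - (∫ x in (0 : ℝ)..1, φ x * profile φ (a * x)) - profile φ a) := by
  have h0 : (0 : ℝ) ∈ Set.Icc (0 : ℝ) 1 := by simp
  have h1 : (1 : ℝ) ∈ Set.Icc (0 : ℝ) 1 := by simp
  have hΦ := hφ.lipBdd_profile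
  have hΦa := hΦ.comp_mul ha
  have i1 := (hΦ.mul hΦa).intervalIntegrable h0 h1
  have i2 := (hΦ.mul hΦ).intervalIntegrable h0 h1
  have i3 := (hφ.lipBdd.mul hΦ).intervalIntegrable h0 h1
  have i4 := (hφ.lipBdd.mul hΦa).intervalIntegrable h0 h1
  have hI : ∫ x in (0 : ℝ)..1,
          ((β - 1) + (β - 1) * (∫ z in x..1, φ z / z) + φ x) *
            (∫ z in (a * x)..x, φ z / z)
      = ∫ x in (0 : ℝ)..1, ((1 - β) * (profile φ x * profile φ x) - φ x * profile φ x)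
          - ((1 - β) * (profile φ x * profile φ (a * x)) - φ x * profile φ (a * x)) := by
    refine intervalIntegral.integral_congr fun x hx => ?_
    rw [Set.uIcc_of_le zero_le_one] at hx
    have hax : a * x ∈ Set.Icc (0 : ℝ) 1 :=
      ⟨mul_nonneg ha.1 hx.1, mul_le_one₀ ha.2 hx.1 hx.2⟩
    have e1 := hφ.profile_sub hax hx
    have e2 : ∫ z in x..1, φ z / z = profile φ x - 1 := by simp [profile]
    rw [← e1, e2]
    ring
  have e2 : ∫ z in a..1, φ z / z = profile φ a - 1 := by simp [profile]
  rw [hI, e2, intervalIntegral.integral_sub ((i2.const_mul _).sub i3) ((i1.const_mul _).sub i4),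
    intervalIntegral.integral_sub (i2.const_mul _) i3,
    intervalIntegral.integral_sub (i1.const_mul _) i4,
    intervalIntegral.integral_const_mul, intervalIntegral.integral_const_mul]
  ring

/-- Only a continuous derivative up to the boundary is extracted from smoothness; the mean value
inequality then gives the Lipschitz constant. -/
lemma exists_of_contDiffOn {φ : ℝ → ℝ} (hsm : ContDiffOn ℝ ∞ φ (Set.Icc 0 1))
    (hnn : ∀ x ∈ Set.Icc (0 : ℝ) 1, 0 ≤ φ x) {δ : ℝ} (hδ : 0 < δ) (hδ1 : δ < 1)
    (hz : ∀ x ∈ Set.Icc (0 : ℝ) δ, φ x = 0) :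
    ContinuousOn (derivWithin φ (Set.Icc 0 1)) (Set.Icc 0 1) ∧
    (∀ x ∈ Set.Ioo (0 : ℝ) 1, HasDerivAt φ (derivWithin φ (Set.Icc 0 1) x) x) ∧
    ∃ B, IsCutoff φ δ B := by
  have hu := uniqueDiffOn_Icc (zero_lt_one (α := ℝ))
  have hc := hsm.continuousOn_derivWithin hu (by simp)
  have hdiff : DifferentiableOn ℝ φ (Set.Icc 0 1) := hsm.differentiableOn (by simp)
  refine ⟨hc, fun x hx => ?_, ?_⟩
  · exact (hdiff x ⟨hx.1.le, hx.2.le⟩).hasDerivWithinAt.hasDerivAt (Icc_mem_nhds hx.1 hx.2)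
  · obtain ⟨C1, hC1⟩ := isCompact_Icc.exists_bound_of_continuousOn hsm.continuousOn
    obtain ⟨C2, hC2⟩ := isCompact_Icc.exists_bound_of_continuousOn hc
    refine ⟨max C1 C2, hδ, hδ1, hnn, hz,
      fun x hx => (hC1 x hx).trans (le_max_left _ _), fun x hx y hy => ?_⟩
    exact (convex_Icc (0 : ℝ) 1).norm_image_sub_le_of_norm_derivWithin_le hdiff
      (fun z hz => (hC2 z hz).trans (le_max_right _ _)) hy hx

end IsCutoff

end

/-! ### Asymptotics and near-monotonicity of the greedy coefficients -/

section
open Filter Topology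

/-- This is the derivative of `(1+t)^c` at `0`, sampled along `t = 1/n`. -/
lemma tendsto_mul_rpow_sub_one (c : ℝ) :
    Tendsto (fun n : ℕ => (n : ℝ) * ((((n : ℝ) + 1) / n) ^ c - 1)) atTop (𝓝 c) := by
  have h1 : HasDerivAt (fun t : ℝ => (1 + t) ^ c) c 0 := by
    have := ((hasDerivAt_id (0 : ℝ)).const_add 1).rpow_const (p := c) (Or.inl (by simp))
    simpa using this
  have h2 : Tendsto (fun n : ℕ => (1 : ℝ) / n) atTop (𝓝[≠] 0) := by
    refine tendsto_nhdsWithin_iff.2 ⟨tendsto_one_div_atTop_nhds_zero_nat, ?_⟩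
    filter_upwards [eventually_gt_atTop 0] with n hn
    have : (0 : ℝ) < n := by exact_mod_cast hn
    simp; omega
  refine (h1.tendsto_slope.comp h2).congr' ?_
  filter_upwards [eventually_gt_atTop 0] with n hn
  have hn' : (0 : ℝ) < n := by exact_mod_cast hn
  have e1 : ((n : ℝ) + 1) / n = 1 + 1 / n := by field_simp
  rw [e1]
  simp [slope]

/-- The prescribed greedy coefficient `q_n = √(n^(2β-1) - (n+1)^(2β-1))`. -/
noncomputable def greedyCoeff (β : ℝ) (n : ℕ) : ℝ :=
  √((n : ℝ) ^ (2 * β - 1) - ((n : ℝ) + 1) ^ (2 * β - 1))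

/-- `n^(1-β) q_n`. -/
noncomputable def scaledCoeff (β : ℝ) (n : ℕ) : ℝ := (n : ℝ) ^ (1 - β) * greedyCoeff β n

/-- `(n+1)^(1-β) q_n`. -/
noncomputable def scaledCoeffSucc (β : ℝ) (n : ℕ) : ℝ :=
  ((n : ℝ) + 1) ^ (1 - β) * greedyCoeff β n

/-- `n^β γ_n`. -/
noncomputable def scaledGamma (β : ℝ) (n : ℕ) : ℝ :=
  n * (1 - (((n : ℝ) + 1) / n) ^ (-(1 - β))) / scaledCoeff β n

variable {β : ℝ}

lemma greedyCoeff_sq (hβ : β < 1 / 2) {n : ℕ} (hn : 0 < n) :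
    greedyCoeff β n ^ 2 = (n : ℝ) ^ (2 * β - 1) - ((n : ℝ) + 1) ^ (2 * β - 1) := by
  have hn' : (0 : ℝ) < n := by exact_mod_cast hn
  refine Real.sq_sqrt (sub_nonneg.2 ?_)
  exact Real.rpow_le_rpow_of_nonpos hn' (by linarith) (by linarith)

lemma greedyCoeff_pos (hβ : β < 1 / 2) {n : ℕ} (hn : 0 < n) : 0 < greedyCoeff β n := by
  have hn' : (0 : ℝ) < n := by exact_mod_cast hn
  refine Real.sqrt_pos.2 (sub_pos.2 ?_)
  exact Real.rpow_lt_rpow_of_neg hn' (by linarith) (by linarith)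

lemma scaledCoeff_pos (hβ : β < 1 / 2) {n : ℕ} (hn : 0 < n) : 0 < scaledCoeff β n := by
  have hn' : (0 : ℝ) < n := by exact_mod_cast hn
  exact mul_pos (Real.rpow_pos_of_pos hn' _) (greedyCoeff_pos hβ hn)

lemma scaledCoeffSucc_pos (hβ : β < 1 / 2) {n : ℕ} (hn : 0 < n) : 0 < scaledCoeffSucc β n := by
  have hn' : (0 : ℝ) < n := by exact_mod_cast hn
  exact mul_pos (Real.rpow_pos_of_pos (by linarith) _) (greedyCoeff_pos hβ hn)

lemma scaledCoeffSucc_eq {n : ℕ} (hn : 0 < n) :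
    scaledCoeffSucc β n = (((n : ℝ) + 1) / n) ^ (1 - β) * scaledCoeff β n := by
  have hn' : (0 : ℝ) < n := by exact_mod_cast hn
  have := (Real.rpow_pos_of_pos hn' (1 - β)).ne'
  rw [scaledCoeffSucc, scaledCoeff, Real.div_rpow (by linarith) hn'.le]
  field_simp

lemma scaledCoeff_sq (hβ : β < 1 / 2) {n : ℕ} (hn : 0 < n) :
    scaledCoeff β n ^ 2 = -(n * ((((n : ℝ) + 1) / n) ^ (2 * β - 1) - 1)) := by
  have hn' : (0 : ℝ) < n := by exact_mod_cast hn
  have h1 := (Real.rpow_pos_of_pos hn' (2 * β - 1)).ne'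
  have h2 : ((n : ℝ) ^ (1 - β)) ^ 2 * (n : ℝ) ^ (2 * β - 1) = n := by
    rw [← Real.rpow_natCast, ← Real.rpow_mul hn'.le, ← Real.rpow_add hn']
    norm_num
    rw [show (1 - β) * 2 + (2 * β - 1) = 1 by ring, Real.rpow_one]
  rw [scaledCoeff, mul_pow, greedyCoeff_sq hβ hn, Real.div_rpow (by linarith) hn'.le]
  have h3 : -((n : ℝ) * (((n : ℝ) + 1) ^ (2 * β - 1) / (n : ℝ) ^ (2 * β - 1) - 1))
      = -((((n : ℝ) ^ (1 - β)) ^ 2 * (n : ℝ) ^ (2 * β - 1))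
        * (((n : ℝ) + 1) ^ (2 * β - 1) / (n : ℝ) ^ (2 * β - 1) - 1)) := by rw [h2]
  rw [h3]
  field_simp
  ring

lemma scaledCoeffSucc_sq (hβ : β < 1 / 2) {n : ℕ} (hn : 0 < n) :
    scaledCoeffSucc β n ^ 2 = ((n : ℝ) + 1) * ((((n : ℝ) + 1) / n) ^ (1 - 2 * β) - 1) := by
  have hn' : (0 : ℝ) < n := by exact_mod_cast hn
  have hn1 : (0 : ℝ) < n + 1 := by linarith
  have h1 := (Real.rpow_pos_of_pos hn' (2 * β - 1)).ne'
  have h1' := (Real.rpow_pos_of_pos hn1 (2 * β - 1)).ne'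
  have h2 : (((n : ℝ) + 1) ^ (1 - β)) ^ 2 * ((n : ℝ) + 1) ^ (2 * β - 1) = n + 1 := by
    rw [← Real.rpow_natCast, ← Real.rpow_mul hn1.le, ← Real.rpow_add hn1]
    norm_num
    rw [show (1 - β) * 2 + (2 * β - 1) = 1 by ring, Real.rpow_one]
  rw [scaledCoeffSucc, mul_pow, greedyCoeff_sq hβ hn, show 1 - 2 * β = -(2 * β - 1) by ring,
    Real.rpow_neg (by positivity), Real.div_rpow (by linarith) hn'.le]
  have h3 : ((n : ℝ) + 1) * (((((n : ℝ) + 1) ^ (2 * β - 1)) / (n : ℝ) ^ (2 * β - 1))⁻¹ - 1)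
      = ((((n : ℝ) + 1) ^ (1 - β)) ^ 2 * ((n : ℝ) + 1) ^ (2 * β - 1))
        * (((((n : ℝ) + 1) ^ (2 * β - 1)) / (n : ℝ) ^ (2 * β - 1))⁻¹ - 1) := by rw [h2]
  rw [h3]
  field_simp

lemma tendsto_scaledCoeff (hβ : β < 1 / 2) :
    Tendsto (scaledCoeff β) atTop (𝓝 √(1 - 2 * β)) := by
  have h1 := ((tendsto_mul_rpow_sub_one (2 * β - 1)).neg).sqrt
  rw [neg_sub] at h1
  refine h1.congr' ?_
  filter_upwards [eventually_gt_atTop 0] with n hn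
  rw [← scaledCoeff_sq hβ hn, Real.sqrt_sq (scaledCoeff_pos hβ hn).le]

lemma tendsto_scaledCoeffSucc (hβ : β < 1 / 2) :
    Tendsto (scaledCoeffSucc β) atTop (𝓝 √(1 - 2 * β)) := by
  have h0 : Tendsto (fun n : ℕ => ((n : ℝ) + 1) / n) atTop (𝓝 1) := by
    have := (tendsto_one_div_atTop_nhds_zero_nat (𝕜 := ℝ)).const_add 1
    rw [add_zero] at this
    refine this.congr' ?_
    filter_upwards [eventually_gt_atTop 0] with n hn
    have hn' : (0 : ℝ) < n := by exact_mod_cast hn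
    field_simp
  have h1 := (h0.rpow_const (p := 1 - β) (Or.inl one_ne_zero)).mul (tendsto_scaledCoeff hβ)
  rw [Real.one_rpow, one_mul] at h1
  refine h1.congr' ?_
  filter_upwards [eventually_gt_atTop 0] with n hn
  rw [scaledCoeffSucc_eq hn]

lemma tendsto_scaledGamma (hβ : β < 1 / 2) :
    Tendsto (scaledGamma β) atTop (𝓝 ((1 - β) / √(1 - 2 * β))) := by
  have h1 := ((tendsto_mul_rpow_sub_one (-(1 - β))).neg).div (tendsto_scaledCoeff hβ)
    (Real.sqrt_pos.2 (by linarith)).ne'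
  rw [neg_neg] at h1
  refine h1.congr fun n => ?_
  simp only [scaledGamma, Pi.div_apply]
  ring

/-- Squared, the claim concerns `(x+1)((1+1/x)^(1-2β) - 1)`. One weighted AM-GM inequality gives
`(1+1/(x+1))^(x+2) ≤ (1+1/x)^(x+1)`, in the form of an exponent `l = (x+1)/(x+2)`. A second one,
`t^l ≤ l t + 1 - l`, converts this exponent into the linear factor. -/
lemma scaledCoeffSucc_succ_le (hβ : β < 1 / 2) {n : ℕ} (hn : 0 < n) :
    scaledCoeffSucc β (n + 1) ≤ scaledCoeffSucc β n := by
  have hn' : (0 : ℝ) < n := by exact_mod_cast hn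
  refine (pow_le_pow_iff_left₀ (scaledCoeffSucc_pos hβ n.succ_pos).le
    (scaledCoeffSucc_pos hβ hn).le two_ne_zero).1 ?_
  rw [scaledCoeffSucc_sq hβ n.succ_pos, scaledCoeffSucc_sq hβ hn]
  push_cast
  set x : ℝ := (n : ℝ) with hx
  set l := (x + 1) / (x + 1 + 1) with hl
  have hl0 : 0 < l := by positivity
  have hl1 : 0 ≤ 1 - l := by
    rw [hl, sub_nonneg, div_le_one (by positivity)]; linarith
  have h1 := Real.geom_mean_le_arith_mean2_weighted hl0.le hl1 (p₁ := x / (x + 1)) (p₂ := 1)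
    (by positivity) zero_le_one (by ring)
  have e1 : l * (x / (x + 1)) + (1 - l) * 1 = l := by
    rw [hl]; field_simp; ring
  rw [e1, Real.one_rpow, mul_one] at h1
  have h2 : (x + 1 + 1) / (x + 1) ≤ ((x + 1) / x) ^ l := by
    have : ((x + 1) / x) ^ l = ((x / (x + 1)) ^ l)⁻¹ := by
      rw [← Real.inv_rpow (by positivity), inv_div]
    rw [this, ← inv_div]
    exact inv_anti₀ (by positivity) h1
  have h3 : ((x + 1 + 1) / (x + 1)) ^ (1 - 2 * β) ≤ ((((x + 1) / x)) ^ (1 - 2 * β)) ^ l := by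
    rw [← Real.rpow_mul (by positivity), mul_comm (1 - 2 * β), Real.rpow_mul (by positivity)]
    exact Real.rpow_le_rpow (by positivity) h2 (by linarith)
  have h4 := Real.geom_mean_le_arith_mean2_weighted hl0.le hl1
    (p₁ := ((x + 1) / x) ^ (1 - 2 * β)) (p₂ := 1) (by positivity) zero_le_one (by ring)
  rw [Real.one_rpow, mul_one] at h4
  have h5 := h3.trans h4
  have h6 : (x + 1 + 1) * (((x + 1 + 1) / (x + 1)) ^ (1 - 2 * β) - 1)
      ≤ (x + 1 + 1) * (l * (((x + 1) / x) ^ (1 - 2 * β) - 1)) := by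
    refine mul_le_mul_of_nonneg_left ?_ (by positivity)
    linarith
  refine h6.trans (le_of_eq ?_)
  rw [← mul_assoc, hl, mul_div_cancel₀ _ (by positivity)]

/-- Changing the normalization in the previous monotonicity costs `((n+1)²/(n(n+2)))^(1-β)`, which
is at most `1 + 1/n²` because `1-β ≤ 1`. An `O(1/n²)` relative loss is affordable in the backward
induction, where each step gains order `1/n`. -/
lemma scaledCoeff_succ_le (hβ0 : 0 < β) (hβ : β < 1 / 2) {n : ℕ} (hn : 0 < n) :
    scaledCoeff β (n + 1) ≤ scaledCoeff β n * (1 + 1 / (n : ℝ) ^ 2) := by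
  have hn' : (0 : ℝ) < n := by exact_mod_cast hn
  have h1 := scaledCoeffSucc_succ_le hβ hn
  rw [scaledCoeffSucc_eq n.succ_pos, scaledCoeffSucc_eq hn] at h1
  push_cast at h1
  set x : ℝ := (n : ℝ) with hx
  have hs := scaledCoeff_pos hβ hn
  set A := ((x + 1 + 1) / (x + 1)) ^ (1 - β)
  have hA : 0 < A := by positivity
  have h2 : ((x + 1) / x) ^ (1 - β) ≤ A * (1 + 1 / x ^ 2) := by
    have e1 : (x + 1) / x = ((x + 1 + 1) / (x + 1)) * ((x + 1) ^ 2 / (x * (x + 2))) := by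
      field_simp; ring
    have h3 : 1 ≤ (x + 1) ^ 2 / (x * (x + 2)) := by
      rw [le_div_iff₀ (by positivity)]; nlinarith
    rw [e1, Real.mul_rpow (by positivity) (by positivity)]
    refine mul_le_mul_of_nonneg_left ?_ hA.le
    calc ((x + 1) ^ 2 / (x * (x + 2))) ^ (1 - β)
        ≤ ((x + 1) ^ 2 / (x * (x + 2))) ^ (1 : ℝ) :=
          Real.rpow_le_rpow_of_exponent_le h3 (by linarith)
      _ = (x + 1) ^ 2 / (x * (x + 2)) := Real.rpow_one _
      _ ≤ 1 + 1 / x ^ 2 := by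
          have e2 : 1 + 1 / x ^ 2 = (x ^ 2 + 1) / x ^ 2 := by field_simp
          rw [e2, div_le_div_iff₀ (by positivity) (by positivity)]
          nlinarith [pow_pos hn' 3]
  have h4 := h1.trans (mul_le_mul_of_nonneg_right h2 hs.le)
  have h5 : A * scaledCoeff β (n + 1) ≤ A * (scaledCoeff β n * (1 + 1 / x ^ 2)) := by
    linarith
  exact le_of_mul_le_mul_left h5 hA

end

/-! ### Volterra recursions and the contraction argument -/

section
open Filter Topology

lemma IsProfile.tendsto_avg {X Y : ℕ → ℕ → ℝ} {f g : ℝ → ℝ} (hX : IsProfile X f)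
    (hY : IsProfile Y g) :
    Tendsto (fun n => avg n (fun i => X n i * Y n i)) atTop
      (𝓝 (∫ x in (0 : ℝ)..1, f x * g x)) := by
  rw [Metric.tendsto_atTop]
  intro ε hε
  obtain ⟨N, hN⟩ := hX.avg_mul hY (half_pos hε)
  refine ⟨N + 1, fun n hn => ?_⟩
  have h1 := hN n (by omega) n le_rfl
  have hn0 : (n : ℝ) ≠ 0 := by exact_mod_cast (by omega : n ≠ 0)
  simp only [div_self hn0, one_mul] at h1
  rw [Real.dist_eq]
  linarith

lemma LipBdd.tendsto_avg {C : ℝ} {f : ℝ → ℝ} (hf : LipBdd C f) :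
    Tendsto (fun n : ℕ => avg n (fun i => f (i / n))) atTop
      (𝓝 (∫ x in (0 : ℝ)..1, f x)) := by
  simpa using (IsProfile.of_lipBdd hf).tendsto_avg (IsProfile.of_lipBdd (LipBdd.const 1))

/-- The array `U` solves a linear Volterra recursion with diagonal `x` and coefficients `y`. -/
def IsVolterra (φ : ℝ → ℝ) (K : ℕ) (x y : ℕ → ℝ) (U : ℕ → ℕ → ℝ) : Prop :=
  ∀ i ≥ K, ∀ n > i, U n i = x i + ∑ m ∈ Finset.Ico (i + 1) n, y m * (φ (i / m) / m)

namespace IsVolterra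

variable {φ : ℝ → ℝ} {δ B : ℝ} {K : ℕ} {x y : ℕ → ℝ} {U : ℕ → ℕ → ℝ}

lemma neg (h : IsVolterra φ K x y U) :
    IsVolterra φ K (fun i => - x i) (fun i => - y i) (fun n i => - U n i) := by
  intro i hi n hn
  simp only [h i hi n hn, neg_add, neg_mul, Finset.sum_neg_distrib]

/-- Because `φ ≥ 0`, upper bounds on the diagonal and the coefficients beyond `M` pass to `U`. The
columns `i ≥ M` only involve indices `m > i`, so eventual bounds are enough. -/
lemma le_add_mul_logSum (hφ : IsCutoff φ δ B) (h : IsVolterra φ K x y U) {M : ℕ} (hM : K ≤ M)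
    {κ₀ κ₁ : ℝ} (hx : ∀ i ≥ M, x i ≤ κ₀) (hy : ∀ i ≥ M, y i ≤ κ₁) {i n : ℕ} (hi : M ≤ i)
    (hn : i < n) : U n i ≤ κ₀ + κ₁ * logSum φ n i := by
  rw [h i (hM.trans hi) n hn, logSum, Finset.mul_sum]
  refine add_le_add (hx i hi) (Finset.sum_le_sum fun m hm => ?_)
  have hm' := (Finset.mem_Ico.1 hm).1
  exact mul_le_mul_of_nonneg_right (hy m (by omega))
    (div_nonneg (hφ.nonneg _ (div_mem_unit (by omega))) (by positivity))

/-- Turns a one-sided eventual bound on the coefficients into a one-sided bound on the limiting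
average; the first `M` columns are negligible. Applied to `-U`, it gives the lower bound as well. -/
lemma eventually_avg_le (hφ : IsCutoff φ δ B) (h : IsVolterra φ K x y U) {D : ℝ}
    (hD : ∀ n i, 1 ≤ i → i < n → |U n i| ≤ D) {κ₀ κ₁ : ℝ} (hx : ∀ᶠ i in atTop, x i ≤ κ₀)
    (hy : ∀ᶠ i in atTop, y i ≤ κ₁) {v : ℝ}
    (hv : κ₀ * (∫ t in (0 : ℝ)..1, φ t)
      + κ₁ * (∫ t in (0 : ℝ)..1, φ t * (profile φ t + -1)) < v) :
    ∀ᶠ n : ℕ in atTop, avg n (fun i => φ (i / n) * U n i) ≤ v := by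
  obtain ⟨M, hM⟩ := ((eventually_ge_atTop K).and (hx.and hy)).exists_forall_of_atTop
  obtain ⟨E, hE⟩ := hφ.isProfile_logSum.bdd
  have hB := hφ.lipBdd.nonneg
  set Q := B * (|D| + (|κ₀| + |κ₁| * |E|)) with hQ
  have hQ0 : 0 ≤ Q := by positivity
  have l1 := (hφ.lipBdd.tendsto_avg).const_mul κ₀
  have l2 := ((IsProfile.of_lipBdd hφ.lipBdd).tendsto_avg hφ.isProfile_logSum).const_mul κ₁
  have l3 : Tendsto (fun n : ℕ => 0 + Q * M / (n : ℝ)) atTop (𝓝 0) := by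
    simpa using tendsto_const_div_atTop_nhds_zero_nat (Q * M)
  have l4 := (l1.add l2).add l3
  rw [add_zero] at l4
  filter_upwards [l4.eventually_lt_const hv] with n hn
  have h1 : avg n (fun i => φ (i / n) * U n i
      - (κ₀ * φ (i / n) + κ₁ * (φ (i / n) * logSum φ n i))) ≤ 0 + Q * M / n := by
    refine avg_le hQ0 le_rfl (fun i i1 i2 => ?_) (fun i i1 iM i2 => ?_)
    · have a1 := hφ.lipBdd.bound _ (div_mem_unit i2.le)
      have a2 := (hD n i i1 i2).trans (le_abs_self D)
      have a3 := (hE n i i1 i2).trans (le_abs_self E)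
      have e1 : φ (i / n) * U n i - (κ₀ * φ (i / n) + κ₁ * (φ (i / n) * logSum φ n i))
          = φ (i / n) * (U n i - (κ₀ + κ₁ * logSum φ n i)) := by ring
      rw [e1]
      refine (le_abs_self _).trans ?_
      rw [abs_mul]
      refine mul_le_mul a1 ?_ (abs_nonneg _) hB
      refine (abs_sub _ _).trans (add_le_add a2 ((abs_add_le _ _).trans ?_))
      rw [abs_mul]
      gcongr
    · have a1 := h.le_add_mul_logSum hφ (hM M le_rfl).1 (fun i hi => (hM i hi).2.1)
        (fun i hi => (hM i hi).2.2) iM i2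
      have a2 := mul_le_mul_of_nonneg_left a1 (hφ.nonneg _ (div_mem_unit i2.le))
      linarith
  rw [avg_sub, avg_add, avg_const_mul, avg_const_mul] at h1
  linarith

lemma eventually_le_avg (hφ : IsCutoff φ δ B) (h : IsVolterra φ K x y U) {D : ℝ}
    (hD : ∀ n i, 1 ≤ i → i < n → |U n i| ≤ D) {κ₀ κ₁ : ℝ} (hx : ∀ᶠ i in atTop, κ₀ ≤ x i)
    (hy : ∀ᶠ i in atTop, κ₁ ≤ y i) {v : ℝ}
    (hv : v < κ₀ * (∫ t in (0 : ℝ)..1, φ t)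
      + κ₁ * (∫ t in (0 : ℝ)..1, φ t * (profile φ t + -1))) :
    ∀ᶠ n : ℕ in atTop, v ≤ avg n (fun i => φ (i / n) * U n i) := by
  have := h.neg.eventually_avg_le hφ (D := D) (by simpa using hD) (κ₀ := -κ₀) (κ₁ := -κ₁)
    (hx.mono fun i hi => neg_le_neg hi) (hy.mono fun i hi => neg_le_neg hi) (v := -v)
    (by linarith)
  filter_upwards [this] with n hn
  have e1 : avg n (fun i => φ (i / n) * -U n i) = - avg n (fun i => φ (i / n) * U n i) := by
    rw [← neg_one_mul, ← avg_const_mul]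
    congr 1
    ext i
    ring
  linarith

/-- When the diagonal and the coefficients both tend to `s`, the formula becomes `s(1 + logSum) ≈
sΦ(i/n)`, the squeeze being applied to `U` and `-U`. -/
lemma isProfile (hφ : IsCutoff φ δ B) (h : IsVolterra φ K x y U) {D : ℝ}
    (hD : ∀ n i, 1 ≤ i → i < n → |U n i| ≤ D) {s : ℝ} (hx : Tendsto x atTop (𝓝 s))
    (hy : Tendsto y atTop (𝓝 s)) : IsProfile U (fun t => s * profile φ t) := by
  refine ⟨⟨_, (LipBdd.const s).mul hφ.lipBdd_profile⟩, ⟨D, hD⟩, fun ε hε => ?_⟩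
  obtain ⟨E', hE'⟩ := hφ.isProfile_logSum.bdd
  set E := |E'|
  have hE : ∀ n i, 1 ≤ i → i < n → logSum φ n i ≤ E := fun n i a b =>
    (le_abs_self _).trans ((hE' n i a b).trans (le_abs_self _))
  have hE0 : 0 ≤ E := abs_nonneg _
  set η := ε / (1 + E + |s|) with hη
  have hη0 : 0 < η := by positivity
  have hx' : ∀ᶠ i in atTop, |x i - s| < η := by
    simpa [Real.dist_eq] using (Metric.tendsto_nhds.1 hx) η hη0
  have hy' : ∀ᶠ i in atTop, |y i - s| < η := by
    simpa [Real.dist_eq] using (Metric.tendsto_nhds.1 hy) η hη0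
  obtain ⟨M, hM⟩ := ((eventually_ge_atTop K).and (hx'.and hy')).exists_forall_of_atTop
  obtain ⟨M', hM'⟩ := hφ.isProfile_logSum.conv η hη0
  refine ⟨max (max M M') 1, fun i hi n hn => ?_⟩
  have hiM : M ≤ i := (le_max_left _ _).trans ((le_max_left _ _).trans hi)
  have hiM' : M' ≤ i := (le_max_right _ _).trans ((le_max_left _ _).trans hi)
  have hi1 : 1 ≤ i := (le_max_right _ _).trans hi
  have up := h.le_add_mul_logSum hφ (hM M le_rfl).1 (κ₀ := s + η) (κ₁ := s + η)
    (fun j hj => by have := abs_lt.1 (hM j hj).2.1; linarith)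
    (fun j hj => by have := abs_lt.1 (hM j hj).2.2; linarith) hiM hn
  have lo := h.neg.le_add_mul_logSum hφ (hM M le_rfl).1 (κ₀ := -(s - η)) (κ₁ := -(s - η))
    (fun j hj => by have := abs_lt.1 (hM j hj).2.1; linarith)
    (fun j hj => by have := abs_lt.1 (hM j hj).2.2; linarith) hiM hn
  have h1 := hM' i hiM' n hn
  have h2 := hE n i hi1 hn
  have h3 : |s * (logSum φ n i - (profile φ (i / n) + -1))| ≤ |s| * η := by
    rw [abs_mul]; gcongr
  have h4 : (1 + E + |s|) * η = ε := by rw [hη]; field_simp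
  have h5 := mul_le_mul_of_nonneg_left h2 hη0.le
  have h6 := abs_le.1 h3
  rw [abs_le]
  constructor <;> nlinarith

end IsVolterra

/-- A multiplicative contraction argument: the solution of `α T = C` converges to `1` when `T` is
asymptotically a positive combination of a constant and of past values of `α`. -/
lemma tendsto_one_of_contraction {α T C : ℕ → ℝ} {s A W lo hi : ℝ} (hs : 0 < s) (hA : 0 < A)
    (hW : 0 ≤ W) (hlo : 0 < lo) (hαlo : ∀ᶠ n in atTop, lo ≤ α n) (hαhi : ∀ᶠ n in atTop, α n ≤ hi)
    (hT : ∀ᶠ n in atTop, 0 < T n) (hC : Tendsto C atTop (𝓝 (s * (A + W))))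
    (heq : ∀ᶠ n in atTop, α n * T n = C n)
    (hup : ∀ ρ > 0, (∀ᶠ n in atTop, α n ≤ ρ) → ∀ v > s * (A + ρ * W), ∀ᶠ n in atTop, T n ≤ v)
    (hdn : ∀ ρ > 0, (∀ᶠ n in atTop, ρ ≤ α n) → ∀ v < s * (A + ρ * W), ∀ᶠ n in atTop, v ≤ T n) :
    Tendsto α atTop (𝓝 1) := by
  -- If `1/ρ ≤ α ≤ ρ` eventually, then `T` lies asymptotically between `s(A + W/ρ)` and `s(A + ρW)`,
  -- so `α = C/T` deviates from `1` by a factor strictly below `ρ`. The ratio `W/(A+W)` is the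
  -- linearized contraction rate; half of the gap `A` is kept as room for the strict inequalities.
  set κ := (W + A / 2) / (A + W) with hκ
  have hAW : 0 < A + W := by linarith
  have hκ0 : 0 ≤ κ := by positivity
  have hκ1 : κ < 1 := by rw [hκ, div_lt_one hAW]; linarith
  have hκe : κ * (A + W) = W + A / 2 := by rw [hκ]; field_simp
  have step : ∀ ρ > 1, (∀ᶠ n in atTop, α n ≤ ρ ∧ 1 ≤ ρ * α n) →
      ∀ᶠ n in atTop, α n ≤ 1 + κ * (ρ - 1) ∧ 1 ≤ (1 + κ * (ρ - 1)) * α n := by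
    intro ρ hρ h
    have hρ0 : 0 < ρ := by linarith
    have ht : 0 < ρ - 1 := by linarith
    set ρ' := 1 + κ * (ρ - 1) with hρ'
    have hρ'0 : 0 < ρ' := by positivity
    have g1 : s * (A + ρ * W) < s * (A + W) * ρ' := by
      have : (A + W) * ρ' = A + ρ * W + A / 2 * (ρ - 1) := by
        rw [hρ']; linear_combination (ρ - 1) * hκe
      rw [mul_assoc, this]
      refine mul_lt_mul_of_pos_left ?_ hs
      nlinarith
    have g2 : s * (A + W) < s * (A + ρ⁻¹ * W) * ρ' := by
      rw [mul_assoc]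
      refine mul_lt_mul_of_pos_left ?_ hs
      have e1 : ρ * (A + W) * ((A + ρ⁻¹ * W) * ρ')
          = (A * ρ + W) * ((A + W) + (W + A / 2) * (ρ - 1)) := by
        rw [← hκe, hρ']; field_simp
      have e2 : ρ * (A + W) * (A + W) < ρ * (A + W) * ((A + ρ⁻¹ * W) * ρ') := by
        rw [e1]
        have : (A * ρ + W) * ((A + W) + (W + A / 2) * (ρ - 1)) - ρ * (A + W) * (A + W)
          = (A + W) * A / 2 * (ρ - 1) + A * (W + A / 2) * (ρ - 1) ^ 2 := by ring
        have : 0 < (A + W) * A / 2 * (ρ - 1) + A * (W + A / 2) * (ρ - 1) ^ 2 := by positivity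
        linarith
      exact lt_of_mul_lt_mul_left e2 (by positivity)
    obtain ⟨v1, hv1, hv1'⟩ := exists_between g1
    have g2' : s * (A + W) / ρ' < s * (A + ρ⁻¹ * W) := by rwa [div_lt_iff₀ hρ'0]
    obtain ⟨v2, hv2, hv2'⟩ := exists_between g2'
    rw [div_lt_iff₀ hρ'0] at hv2
    have c1 := (hC.mul_const ρ').eventually_const_lt hv1'
    have c2 := hC.eventually_lt_const hv2
    have t1 := hup ρ hρ0 (h.mono fun n hn => hn.1) v1 hv1
    have t2 := hdn ρ⁻¹ (by positivity) (h.mono fun n hn => by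
      rw [inv_le_iff_one_le_mul₀ hρ0, mul_comm]; exact hn.2) v2 hv2'
    filter_upwards [c1, c2, t1, t2, hT, heq] with n c1 c2 t1 t2 hT heq
    constructor
    · refine le_of_mul_le_mul_right ?_ hT
      rw [heq]
      nlinarith
    · refine le_of_mul_le_mul_right ?_ hT
      rw [mul_assoc, heq]
      linarith
  obtain ⟨ρ, hρ1, hρ⟩ : ∃ ρ > 1, ∀ᶠ n in atTop, α n ≤ ρ ∧ 1 ≤ ρ * α n := by
    refine ⟨max (max 2 hi) lo⁻¹, lt_of_lt_of_le one_lt_two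
      ((le_max_left _ _).trans (le_max_left _ _)), ?_⟩
    filter_upwards [hαlo, hαhi] with n h1 h2
    refine ⟨h2.trans ((le_max_right _ _).trans (le_max_left _ _)), ?_⟩
    calc (1 : ℝ) = lo⁻¹ * lo := (inv_mul_cancel₀ hlo.ne').symm
      _ ≤ _ := mul_le_mul (le_max_right _ _) h1 hlo.le
        ((inv_nonneg.2 hlo.le).trans (le_max_right _ _))
  -- Taking the maximum with `1/2` only secures a visibly positive ratio.
  have iter : ∀ k : ℕ, ∀ᶠ n in atTop,
      α n ≤ 1 + max κ (1 / 2) ^ k * (ρ - 1) ∧ 1 ≤ (1 + max κ (1 / 2) ^ k * (ρ - 1)) * α n := by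
    intro k
    have ht : 0 < ρ - 1 := by linarith
    have hm : 0 < max κ (1 / 2) := lt_max_of_lt_right (by norm_num)
    induction k with
    | zero => simpa using hρ
    | succ k ih =>
      have hp : 0 < max κ (1 / 2) ^ k * (ρ - 1) := by positivity
      filter_upwards [step _ (by linarith) ih, hαlo] with n hn hl
      have : κ * (1 + max κ (1 / 2) ^ k * (ρ - 1) - 1) ≤ max κ (1 / 2) ^ (k + 1) * (ρ - 1) := by
        rw [pow_succ']
        have := mul_le_mul_of_nonneg_right (le_max_left κ (1 / 2)) hp.le
        linarith
      refine ⟨hn.1.trans (by linarith), hn.2.trans ?_⟩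
      exact mul_le_mul_of_nonneg_right (by linarith) (hlo.le.trans hl)
  rw [Metric.tendsto_atTop]
  intro ε hε
  have hlim : Tendsto (fun k : ℕ => max κ (1 / 2) ^ k * (ρ - 1)) atTop (𝓝 0) := by
    have := (tendsto_pow_atTop_nhds_zero_of_lt_one (hκ0.trans (le_max_left _ _))
      (max_lt hκ1 (by norm_num : (1 / 2 : ℝ) < 1))).mul_const (ρ - 1)
    rwa [zero_mul] at this
  obtain ⟨k, hk⟩ := (hlim.eventually_lt_const hε).exists
  obtain ⟨N, hN⟩ := ((iter k).and hαlo).exists_forall_of_atTop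
  refine ⟨N, fun n hn => ?_⟩
  obtain ⟨⟨h1, h2⟩, h3⟩ := hN n hn
  set t := max κ (1 / 2) ^ k * (ρ - 1)
  rw [Real.dist_eq, abs_lt]
  constructor
  · by_contra hcon
    have : α n ≤ 1 - ε := by linarith
    nlinarith
  · linarith

end

/-! ### Construction of the coordinates and uniform step bounds -/

section
open Filter Topology

/-- The value of `α_n` determined by the rescaled coordinates `V` of `-r_{n-1}`. -/
noncomputable def alphaOf (β : ℝ) (φ : ℝ → ℝ) (n : ℕ) (V : ℕ → ℝ) : ℝ :=
  (scaledGamma β n - scaledCoeff β n) / avg n (fun i => φ (i / n) * V i)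

/-- The value of `ξ_n` determined by the rescaled coordinates `V` of `-r_{n-1}`. -/
noncomputable def xiOf (β : ℝ) (φ : ℝ → ℝ) (n : ℕ) (V : ℕ → ℝ) : ℝ :=
  √(1 - avg n (fun i => (scaledGamma β n * V i - alphaOf β φ n V * φ (i / n)) ^ 2) / n)

/-- The coordinates of `-n^(1-β) r_{n-1}`. -/
noncomputable def coord (β : ℝ) (φ : ℝ → ℝ) (K : ℕ) : ℕ → ℕ → ℝ
  | 0 => fun _ => √(K / (K - 1))
  | n + 1 => if n < K then fun _ => √(K / (K - 1)) else fun i =>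
      if i < n then coord β φ K n i
        + scaledCoeffSucc β n * (alphaOf β φ n (coord β φ K n) * (φ (i / n) / n))
      else scaledCoeffSucc β n * xiOf β φ n (coord β φ K n)

/-- The sequence `α_n`. -/
noncomputable def alpha (β : ℝ) (φ : ℝ → ℝ) (K n : ℕ) : ℝ := alphaOf β φ n (coord β φ K n)

/-- The sequence `ξ_n`. -/
noncomputable def xi (β : ℝ) (φ : ℝ → ℝ) (K n : ℕ) : ℝ := xiOf β φ n (coord β φ K n)

variable {β : ℝ} {φ : ℝ → ℝ} {K : ℕ}

lemma coord_of_le {n : ℕ} (hn : n ≤ K) (i : ℕ) : coord β φ K n i = √(K / (K - 1)) := by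
  cases n with
  | zero => rfl
  | succ n => rw [coord, if_pos (by omega)]

/-- There is no damping of old coordinates: the choice of `γ_n` makes `1 - q_n γ_n` equal to
`(n/(n+1))^(1-β)`, which the new normalization cancels. -/
lemma coord_succ_of_lt {n i : ℕ} (hn : K ≤ n) (hi : i < n) :
    coord β φ K (n + 1) i
      = coord β φ K n i + scaledCoeffSucc β n * alpha β φ K n * (φ (i / n) / n) := by
  rw [coord, if_neg (by omega)]
  simp only [if_pos hi, alpha]
  ring

lemma coord_succ_self {n : ℕ} (hn : K ≤ n) :
    coord β φ K (n + 1) n = scaledCoeffSucc β n * xi β φ K n := by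
  rw [coord, if_neg (by omega)]
  simp [xi]

lemma isVolterra_coord : IsVolterra φ K (fun i => scaledCoeffSucc β i * xi β φ K i)
    (fun m => scaledCoeffSucc β m * alpha β φ K m) (coord β φ K) := by
  intro i hi n hn
  induction n, hn using Nat.le_induction with
  | base => simp [coord_succ_self hi]
  | succ n hn ih =>
    have hin : i < n := hn
    rw [coord_succ_of_lt (hi.trans hin.le) hin, ih, Finset.sum_Ico_succ_top hn]
    ring

/-- The bounds satisfied by the iteration at step `n`. -/
structure StepBounds (β : ℝ) (φ : ℝ → ℝ) (K : ℕ) (a₀ a₁ : ℝ) (n : ℕ) : Prop where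
  coord_ge : ∀ i, 1 ≤ i → i < n → √(1 - 2 * β) / 4 ≤ coord β φ K n i
  avg_pos : 0 < avg n (fun i => φ (i / n) * coord β φ K n i)
  alpha_ge : a₀ ≤ alpha β φ K n
  alpha_le : alpha β φ K n ≤ a₁
  xi_ge : 1 / 2 ≤ xi β φ K n
  xi_le : xi β φ K n ≤ 1
  xi_sq : xi β φ K n ^ 2 = 1 - avg n (fun i =>
    (scaledGamma β n * coord β φ K n i - alpha β φ K n * φ (i / n)) ^ 2) / n

lemma scaledGamma_sub_scaledCoeff_tendsto (hβ : β < 1 / 2) :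
    Tendsto (fun n => scaledGamma β n - scaledCoeff β n) atTop (𝓝 (β / √(1 - 2 * β))) := by
  have h := (tendsto_scaledGamma hβ).sub (tendsto_scaledCoeff hβ)
  convert h using 2
  have hs : 0 < √(1 - 2 * β) := Real.sqrt_pos.2 (by linarith)
  rw [eq_sub_iff_add_eq, div_add' _ _ _ hs.ne', Real.mul_self_sqrt (by linarith)]
  congr 1; ring


lemma sqrt_one_sub_pos (hβ : β < 1 / 2) : 0 < √(1 - 2 * β) := Real.sqrt_pos.2 (by linarith)

lemma avg_le_const {n : ℕ} {w : ℕ → ℝ} {D : ℝ} (hD : 0 ≤ D)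
    (h : ∀ i, 1 ≤ i → i < n → w i ≤ D) : avg n w ≤ D := by
  have := avg_le (M := 0) hD hD h (fun i a _ c => h i a c)
  simpa using this

lemma avg_coord_sq {n : ℕ} (hn : 0 < n)
    (hsq : ∑ i ∈ Finset.Ico 1 n, coord β φ K n i ^ 2 = n) :
    avg n (fun i => coord β φ K n i ^ 2) = 1 := by
  have : (n : ℝ) ≠ 0 := by exact_mod_cast hn.ne'
  rw [avg, hsq, div_self this]

/-- The parameters `α_n` and `ξ_n` satisfy uniform bounds as soon as the coordinates do. -/
lemma exists_stepBounds {δ B : ℝ} (hβ0 : 0 < β) (hβ : β < 1 / 2) (hφ : IsCutoff φ δ B)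
    (hA : 0 < ∫ x in (0 : ℝ)..1, φ x) :
    ∃ a₀ a₁ : ℝ, 0 < a₀ ∧ ∃ K₀ : ℕ, 1 < K₀ ∧ ∀ K, ∀ n ≥ K₀,
      (∀ i, 1 ≤ i → i < n → √(1 - 2 * β) / 4 ≤ coord β φ K n i) →
      ∑ i ∈ Finset.Ico 1 n, coord β φ K n i ^ 2 = n →
      StepBounds β φ K a₀ a₁ n ∧ √(1 - 2 * β) / 2 ≤ scaledCoeffSucc β n ∧
        scaledCoeffSucc β n ≤ 2 * √(1 - 2 * β) := by
  have hs := sqrt_one_sub_pos hβ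
  set s := √(1 - 2 * β) with hsdef
  set A := ∫ x in (0 : ℝ)..1, φ x
  set c := β / s with hc
  have hc0 : 0 < c := by positivity
  have hB := hφ.lipBdd.nonneg
  -- The numerator of `α_n` tends to `c = β/s`, so it is eventually at most `2c`; the denominator is
  -- at least `s/4` times an average of `φ` that is eventually at least `A/2`.
  set a₁ := 2 * c / (s / 4 * (A / 2)) with ha₁
  have ha₁0 : 0 < a₁ := by positivity
  have hb := tendsto_scaledCoeffSucc hβ
  have hC := scaledGamma_sub_scaledCoeff_tendsto hβ
  have hg := tendsto_scaledGamma hβ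
  have hlim : Tendsto (fun n : ℕ => (scaledGamma β n ^ 2 + a₁ ^ 2 * B ^ 2) / n) atTop (𝓝 0) :=
    ((hg.pow 2).add_const _).div_atTop tendsto_natCast_atTop_atTop
  have ev : ∀ᶠ n in atTop, s / 2 ≤ scaledCoeffSucc β n ∧ scaledCoeffSucc β n ≤ 2 * s ∧
      c / 2 ≤ scaledGamma β n - scaledCoeff β n ∧ scaledGamma β n - scaledCoeff β n ≤ 2 * c ∧
      A / 2 ≤ avg n (fun i => φ (i / n)) ∧ 0 ≤ scaledGamma β n ∧
      (scaledGamma β n ^ 2 + a₁ ^ 2 * B ^ 2) / n ≤ 3 / 4 := by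
    filter_upwards [hb.eventually_const_le (half_lt_self hs),
      hb.eventually_le_const (by linarith : s < 2 * s),
      hC.eventually_const_le (half_lt_self hc0),
      hC.eventually_le_const (by linarith : c < 2 * c),
      hφ.lipBdd.tendsto_avg.eventually_const_le (half_lt_self hA),
      hg.eventually_const_le (div_pos (by linarith : 0 < 1 - β) hs),
      hlim.eventually_le_const (by norm_num : (0 : ℝ) < 3 / 4)]
      with n h1 h2 h3 h4 h5 h6 h7 using ⟨h1, h2, h3, h4, h5, h6, h7⟩
  obtain ⟨N, hN⟩ := ev.exists_forall_of_atTop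
  refine ⟨c / (B ^ 2 + 1), a₁, by positivity, max N 2,
    lt_of_lt_of_le one_lt_two (le_max_right _ _), fun K n hn hco hsq => ?_⟩
  obtain ⟨h1, h2, h3, h4, h5, h6, h7⟩ := hN n ((le_max_left _ _).trans hn)
  have hn2 : 2 ≤ n := (le_max_right _ _).trans hn
  have hn0 : (0 : ℝ) < n := by exact_mod_cast (by omega : 0 < n)
  have hφ0 : ∀ i, i < n → 0 ≤ φ (i / n) := fun i hi => hφ.nonneg _ (div_mem_unit hi.le)
  have hφB : ∀ i, i < n → φ (i / n) ^ 2 ≤ B ^ 2 := fun i hi =>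
    sq_le_sq' (by linarith [hφ0 i hi]) ((le_abs_self _).trans (hφ.lipBdd.bound _ (div_mem_unit hi.le)))
  have hU0 : ∀ i, 1 ≤ i → i < n → 0 ≤ coord β φ K n i := fun i a b =>
    le_trans (by positivity) (hco i a b)
  set T := avg n (fun i => φ (i / n) * coord β φ K n i) with hT
  have hT1 : s / 4 * (A / 2) ≤ T := by
    have : avg n (fun i => s / 4 * φ (i / n)) ≤ T := avg_mono fun i a b => by
      rw [mul_comm]; exact mul_le_mul_of_nonneg_left (hco i a b) (hφ0 i b)
    rw [avg_const_mul] at this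
    exact (mul_le_mul_of_nonneg_left h5 (by positivity)).trans this
  -- Here `2φU ≤ φ² + U²` and the normalization `avg U² = 1` give a bound without any upper bound on
  -- the coordinates.
  have hT2 : T ≤ (B ^ 2 + 1) / 2 := by
    have e1 : T ≤ avg n (fun i => 1 / 2 * B ^ 2 + 1 / 2 * coord β φ K n i ^ 2) :=
      avg_mono fun i a b => by
        nlinarith [hφB i b, sq_nonneg (φ (i / n) - coord β φ K n i)]
    rw [avg_add, avg_const_mul n (1 / 2) (fun i => coord β φ K n i ^ 2),
      avg_coord_sq (by omega) hsq] at e1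
    have e2 : avg n (fun _ => 1 / 2 * B ^ 2) ≤ 1 / 2 * B ^ 2 :=
      avg_le_const (by positivity) fun _ _ _ => le_rfl
    linarith
  have hT0 : 0 < T := lt_of_lt_of_le (by positivity) hT1
  have hα : alpha β φ K n = (scaledGamma β n - scaledCoeff β n) / T := rfl
  have hαlo : c / (B ^ 2 + 1) ≤ alpha β φ K n := by
    rw [hα, div_le_div_iff₀ (by positivity) hT0]
    nlinarith [mul_le_mul_of_nonneg_left hT2 hc0.le]
  have hα0 : 0 ≤ alpha β φ K n := le_trans (by positivity) hαlo
  have hαhi : alpha β φ K n ≤ a₁ := by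
    rw [hα, ha₁]
    exact div_le_div₀ (by positivity) h4 (by positivity) hT1
  have hQ : avg n (fun i =>
      (scaledGamma β n * coord β φ K n i - alpha β φ K n * φ (i / n)) ^ 2)
      ≤ scaledGamma β n ^ 2 + a₁ ^ 2 * B ^ 2 := by
    have e1 : avg n (fun i =>
        (scaledGamma β n * coord β φ K n i - alpha β φ K n * φ (i / n)) ^ 2)
        ≤ avg n (fun i => scaledGamma β n ^ 2 * coord β φ K n i ^ 2 + a₁ ^ 2 * B ^ 2) := by
      refine avg_mono fun i a b => ?_
      have m1 : 0 ≤ (scaledGamma β n * coord β φ K n i) * (alpha β φ K n * φ (i / n)) :=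
        mul_nonneg (mul_nonneg h6 (hU0 i a b)) (mul_nonneg hα0 (hφ0 i b))
      have m2 : alpha β φ K n ^ 2 * φ (i / n) ^ 2 ≤ a₁ ^ 2 * B ^ 2 :=
        mul_le_mul (pow_le_pow_left₀ hα0 hαhi 2) (hφB i b) (sq_nonneg _) (sq_nonneg _)
      nlinarith
    rw [avg_add, avg_const_mul n _ (fun i => coord β φ K n i ^ 2),
      avg_coord_sq (by omega) hsq] at e1
    have e2 : avg n (fun _ => a₁ ^ 2 * B ^ 2) ≤ a₁ ^ 2 * B ^ 2 :=
      avg_le_const (by positivity) fun _ _ _ => le_rfl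
    linarith
  set Q := avg n (fun i =>
      (scaledGamma β n * coord β φ K n i - alpha β φ K n * φ (i / n)) ^ 2) with hQdef
  have hQ0 : 0 ≤ Q := div_nonneg (Finset.sum_nonneg fun _ _ => sq_nonneg _) hn0.le
  have hQn : Q / n ≤ 3 / 4 := le_trans (by gcongr) h7
  have hQn0 : 0 ≤ Q / n := by positivity
  have hξ : xi β φ K n = √(1 - Q / n) := rfl
  -- The radicand is at least `1/4`, so the square root is not truncated and `ξ_n ≥ 1/2`.
  have hξsq : xi β φ K n ^ 2 = 1 - Q / n := by rw [hξ, Real.sq_sqrt (by linarith)]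
  have hξ0 : 0 ≤ xi β φ K n := by rw [hξ]; positivity
  exact ⟨⟨hco, hT0, hαlo, hαhi, by nlinarith, by nlinarith, hξsq⟩, h1, h2⟩

lemma StepBounds.alpha_mul_avg {a₀ a₁ : ℝ} {n : ℕ} (h : StepBounds β φ K a₀ a₁ n) :
    alpha β φ K n * avg n (fun i => φ (i / n) * coord β φ K n i)
      = scaledGamma β n - scaledCoeff β n :=
  div_mul_cancel₀ _ h.avg_pos.ne'

/-- In rescaled form this is Pythagoras, `‖r_n‖² = ‖r_{n-1}‖² - q_n²`: the value of `α_n` fixes the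
cross term and that of `ξ_n` the norm of the direction. The prescribed `q_n` then turns `n - s_n²`
into `n w^(2β-1)`, with `w = (n+1)/n`. -/
lemma StepBounds.sum_sq_succ {a₀ a₁ : ℝ} (hβ : β < 1 / 2) {n : ℕ} (hn : 0 < n) (hKn : K ≤ n)
    (h : StepBounds β φ K a₀ a₁ n)
    (hsq : ∑ i ∈ Finset.Ico 1 n, coord β φ K n i ^ 2 = n) :
    ∑ i ∈ Finset.Ico 1 (n + 1), coord β φ K (n + 1) i ^ 2 = (n + 1 : ℕ) := by
  have hn0 : (0 : ℝ) < n := by exact_mod_cast hn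
  have hT := h.alpha_mul_avg
  have hξ := h.xi_sq
  have hU := avg_coord_sq hn hsq
  set g := scaledGamma β n with hg
  set s := scaledCoeff β n with hs
  set b := scaledCoeffSucc β n with hb
  set α := alpha β φ K n
  set T := avg n (fun i => φ (i / n) * coord β φ K n i)
  set P := avg n (fun i => φ (i / n) ^ 2) with hP
  have hs0 : 0 < s := scaledCoeff_pos hβ hn
  have e1 : ∑ i ∈ Finset.Ico 1 n, coord β φ K (n + 1) i ^ 2
      = n * avg n (fun i => coord β φ K n i ^ 2 + (2 * b * α / n * (φ (i / n) * coord β φ K n i)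
        + (b * α / n) ^ 2 * φ (i / n) ^ 2)) := by
    rw [avg, mul_div_cancel₀ _ hn0.ne']
    refine Finset.sum_congr rfl fun i hi => ?_
    rw [coord_succ_of_lt hKn (Finset.mem_Ico.1 hi).2]
    ring
  have e2 : avg n (fun i => (g * coord β φ K n i - α * φ (i / n)) ^ 2)
      = g ^ 2 - 2 * g * α * T + α ^ 2 * P := by
    have : (fun i : ℕ => (g * coord β φ K n i - α * φ (i / n)) ^ 2)
        = fun i : ℕ => (g ^ 2 * coord β φ K n i ^ 2 - 2 * g * α * (φ (i / n) * coord β φ K n i))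
          + α ^ 2 * φ (i / n) ^ 2 := by
      ext i; ring
    rw [this, avg_add, avg_sub, avg_const_mul n (g ^ 2) (fun i => coord β φ K n i ^ 2),
      avg_const_mul, avg_const_mul n (α ^ 2) (fun i => φ (i / n) ^ 2), hU]
    ring
  rw [Finset.sum_Ico_succ_top hn, e1, coord_succ_self hKn, mul_pow, hξ, e2, avg_add, avg_add,
    avg_const_mul, avg_const_mul n _ (fun i => φ (i / n) ^ 2), hU, ← hP]
  set w := ((n : ℝ) + 1) / n with hw
  have hw0 : 0 < w := by positivity
  have hν := scaledCoeffSucc_eq (β := β) hn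
  have hs2 := scaledCoeff_sq hβ hn
  rw [← hw, ← hs] at hν hs2
  rw [← hb] at hν
  have hgs : g * s = n * (1 - (w ^ (1 - β))⁻¹) := by
    rw [hg, scaledGamma, ← hs, ← hw, Real.rpow_neg hw0.le, div_mul_cancel₀ _ hs0.ne']
  have hww : (w ^ (1 - β)) ^ 2 * w ^ (2 * β - 1) = w := by
    rw [← Real.rpow_natCast, ← Real.rpow_mul hw0.le, ← Real.rpow_add hw0]
    norm_num
    rw [show (1 - β) * 2 + (2 * β - 1) = 1 by ring, Real.rpow_one]
  set ν := w ^ (1 - β)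
  have hν0 : 0 < ν := by positivity
  have hnw : n * w = n + 1 := by rw [hw]; field_simp
  have hbg : b * g = n * (ν - 1) := by
    rw [hν, mul_assoc, mul_comm s, hgs]; field_simp
  have goal1 : n * (1 + (2 * b * α / n * T + (b * α / n) ^ 2 * P))
      + b ^ 2 * (1 - (g ^ 2 - 2 * g * α * T + α ^ 2 * P) / n)
      = n + 2 * b * (α * T) + b ^ 2 - (b * g) ^ 2 / n + 2 * b * (b * g) * (α * T) / n := by
    field_simp
    ring
  rw [goal1, hT]
  have goal2 : n + 2 * b * (g - s) + b ^ 2 - (b * g) ^ 2 / n + 2 * b * (b * g) * (g - s) / n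
      = ν ^ 2 * (n - s ^ 2) := by
    have : n + 2 * b * (g - s) + b ^ 2 - (b * g) ^ 2 / n + 2 * b * (b * g) * (g - s) / n
      = n + 2 * (b * g) - 2 * b * s + b ^ 2 + (b * g) ^ 2 / n - 2 * (b * g) * (b * s) / n := by
      ring
    rw [this, hbg, hν]
    field_simp
    ring
  rw [goal2, hs2]
  push_cast
  linear_combination (n : ℝ) * hww + hnw

/-- For large `K` the bounds hold at every step, whatever `K` is. -/
theorem exists_forall_stepBounds {δ B : ℝ} (hβ0 : 0 < β) (hβ : β < 1 / 2) (hφ : IsCutoff φ δ B)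
    (hA : 0 < ∫ x in (0 : ℝ)..1, φ x) :
    ∃ a₀ a₁ : ℝ, 0 < a₀ ∧ ∃ K₀ : ℕ, 1 < K₀ ∧ ∀ K ≥ K₀, ∀ n ≥ K,
      StepBounds β φ K a₀ a₁ n ∧ ∑ i ∈ Finset.Ico 1 n, coord β φ K n i ^ 2 = n ∧
        scaledCoeffSucc β n ≤ 2 * √(1 - 2 * β) := by
  obtain ⟨a₀, a₁, ha₀, K₀, hK₀, H⟩ := exists_stepBounds hβ0 hβ hφ hA
  refine ⟨a₀, a₁, ha₀, K₀, hK₀, fun K hK => ?_⟩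
  have hs := sqrt_one_sub_pos hβ
  have hs1 : √(1 - 2 * β) ≤ 1 := by
    exact Real.sqrt_le_iff.2 ⟨zero_le_one, by linarith⟩
  have hK1 : (1 : ℝ) < K := by exact_mod_cast hK₀.trans_le hK
  -- Existing coordinates never decrease, since `α_n` and `φ` are nonnegative, and each new one is
  -- `b_n ξ_n ≥ (s/2)(1/2)`. Thus the bound `s/4` reproduces itself with a threshold independent of
  -- `K`.
  have main : ∀ n ≥ K, (∀ i, 1 ≤ i → i < n → √(1 - 2 * β) / 4 ≤ coord β φ K n i) ∧
      ∑ i ∈ Finset.Ico 1 n, coord β φ K n i ^ 2 = n := by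
    intro n hn
    induction n, hn using Nat.le_induction with
    | base =>
      have hq : 1 ≤ (K : ℝ) / (K - 1) := by
        rw [le_div_iff₀ (by linarith)]; linarith
      refine ⟨fun i _ _ => ?_, ?_⟩
      · rw [coord_of_le le_rfl]
        have := Real.one_le_sqrt.2 hq
        linarith
      · simp only [coord_of_le le_rfl, Real.sq_sqrt (zero_le_one.trans hq), Finset.sum_const,
          Nat.card_Ico, nsmul_eq_mul]
        rw [Nat.cast_sub (by omega)]
        have : (K : ℝ) - 1 ≠ 0 := by linarith
        push_cast
        field_simp
    | succ n hn ih =>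
      obtain ⟨hb, hlo, hup⟩ := H K n (hK.trans hn) ih.1 ih.2
      have hn0 : 0 < n := by omega
      refine ⟨fun i i1 i2 => ?_, hb.sum_sq_succ hβ hn0 hn ih.2⟩
      rcases (Nat.lt_succ_iff.1 i2).lt_or_eq with hi | rfl
      · rw [coord_succ_of_lt hn hi]
        have h1 := ih.1 i i1 hi
        have h2 : 0 ≤ scaledCoeffSucc β n * alpha β φ K n * (φ (i / n) / n) :=
          mul_nonneg (mul_nonneg (scaledCoeffSucc_pos hβ hn0).le (ha₀.le.trans hb.alpha_ge))
            (div_nonneg (hφ.nonneg _ (div_mem_unit hi.le)) (by positivity))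
        linarith
      · rw [coord_succ_self hn]
        nlinarith [hb.xi_ge, hb.xi_le]
  intro n hn
  obtain ⟨h1, -, h3⟩ := H K n (hK.trans hn) (main n hn).1 (main n hn).2
  exact ⟨h1, (main n hn).2, h3⟩

end

/-! ### Convergence of the parameters -/

section
open Filter Topology

variable {β : ℝ} {φ : ℝ → ℝ} {K : ℕ} {δ B a₀ a₁ : ℝ}

/-- The starting value is either the initial constant or `b_i ξ_i ≤ 2s`, and the increments sum to
at most a multiple of `logSum`, which is uniformly bounded. -/
lemma coord_le (hβ : β < 1 / 2) (hφ : IsCutoff φ δ B) (hK : 0 < K)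
    (hst : ∀ n ≥ K, StepBounds β φ K a₀ a₁ n)
    (ha₀ : 0 < a₀) (hb : ∀ n ≥ K, scaledCoeffSucc β n ≤ 2 * √(1 - 2 * β)) {n i : ℕ}
    (hin : i < n) :
    coord β φ K n i ≤ max (√(K / (K - 1))) (2 * √(1 - 2 * β))
      + 2 * √(1 - 2 * β) * a₁ * logSum φ n i := by
  have hs := sqrt_one_sub_pos hβ
  have ha₁ : 0 < a₁ := ha₀.trans_le ((hst K le_rfl).alpha_ge.trans (hst K le_rfl).alpha_le)
  have hpos : ∀ m, 0 ≤ 2 * √(1 - 2 * β) * a₁ * logSum φ m i := fun m =>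
    mul_nonneg (by positivity) (hφ.logSum_nonneg _ _)
  rcases le_total n K with h | h
  · rw [coord_of_le h]
    linarith [hpos n, le_max_left (√((K : ℝ) / (K - 1))) (2 * √(1 - 2 * β))]
  induction n, h using Nat.le_induction with
  | base =>
    rw [coord_of_le le_rfl]
    linarith [hpos K, le_max_left (√((K : ℝ) / (K - 1))) (2 * √(1 - 2 * β))]
  | succ n hn ih =>
    have hb0 := (scaledCoeffSucc_pos hβ (hK.trans_le hn)).le
    rcases (Nat.lt_succ_iff.1 hin).lt_or_eq with hi | rfl
    · rw [coord_succ_of_lt hn hi]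
      have e1 : logSum φ (n + 1) i = logSum φ n i + φ (i / n) / n := by
        rw [logSum, Finset.sum_Ico_succ_top hi, ← logSum]
      have h2 : scaledCoeffSucc β n * alpha β φ K n ≤ 2 * √(1 - 2 * β) * a₁ :=
        mul_le_mul (hb n hn) (hst n hn).alpha_le (ha₀.le.trans (hst n hn).alpha_ge)
          (by positivity)
      have h3 := mul_le_mul_of_nonneg_right h2
        (div_nonneg (hφ.nonneg _ (div_mem_unit hi.le)) (by positivity) : 0 ≤ φ (i / n) / n)
      rw [e1]
      linarith [ih hi]
    · rw [coord_succ_self hn]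
      have h2 := mul_le_mul (hb i hn) (hst i hn).xi_le (by linarith [(hst i hn).xi_ge])
        (by positivity)
      linarith [hpos (i + 1), le_max_right (√((K : ℝ) / (K - 1))) (2 * √(1 - 2 * β))]

lemma exists_abs_coord_le (hβ : β < 1 / 2) (hφ : IsCutoff φ δ B) (hK : 0 < K)
    (hst : ∀ n ≥ K, StepBounds β φ K a₀ a₁ n)
    (ha₀ : 0 < a₀) (hb : ∀ n ≥ K, scaledCoeffSucc β n ≤ 2 * √(1 - 2 * β)) :
    ∃ D, ∀ n i, 1 ≤ i → i < n → |coord β φ K n i| ≤ D := by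
  have hs := sqrt_one_sub_pos hβ
  have ha₁ : 0 < a₁ := ha₀.trans_le ((hst K le_rfl).alpha_ge.trans (hst K le_rfl).alpha_le)
  obtain ⟨E, hE⟩ := hφ.isProfile_logSum.bdd
  refine ⟨max (√(K / (K - 1))) (2 * √(1 - 2 * β)) + 2 * √(1 - 2 * β) * a₁ * E,
    fun n i i1 i2 => ?_⟩
  have h0 : 0 ≤ coord β φ K n i := by
    rcases le_total n K with h | h
    · rw [coord_of_le h]; positivity
    · exact le_trans (by positivity) ((hst n h).coord_ge i i1 i2)
  rw [abs_of_nonneg h0]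
  refine (coord_le hβ hφ hK hst ha₀ hb i2).trans ?_
  gcongr
  exact (le_abs_self _).trans (hE n i i1 i2)

/-- Bounded coordinates and parameters give `1 - ξ_n² = O(1/n)`, and `ξ_n ≥ ξ_n²` because `0 ≤ ξ_n ≤
1`. -/
lemma tendsto_xi (hβ : β < 1 / 2) (hφ : IsCutoff φ δ B) (hK : 0 < K)
    (hst : ∀ n ≥ K, StepBounds β φ K a₀ a₁ n)
    (ha₀ : 0 < a₀) (hb : ∀ n ≥ K, scaledCoeffSucc β n ≤ 2 * √(1 - 2 * β)) :
    Tendsto (xi β φ K) atTop (𝓝 1) := by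
  obtain ⟨D', hD'⟩ := exists_abs_coord_le hβ hφ hK hst ha₀ hb
  have hD : ∀ n i, 1 ≤ i → i < n → |coord β φ K n i| ≤ |D'| := fun n i a b =>
    (hD' n i a b).trans (le_abs_self _)
  have hB := hφ.lipBdd.nonneg
  have hg := tendsto_scaledGamma hβ
  have hlim : Tendsto (fun n : ℕ => 1 - ((|scaledGamma β n| * |D'| + a₁ * B) ^ 2) / (n : ℝ)) atTop
      (𝓝 (1 - 0)) :=
    ((((hg.abs.mul_const _).add_const _).pow 2).div_atTop tendsto_natCast_atTop_atTop).const_sub 1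
  rw [sub_zero] at hlim
  refine tendsto_of_tendsto_of_tendsto_of_le_of_le' hlim tendsto_const_nhds ?_ ?_
  · filter_upwards [eventually_ge_atTop K] with n hn
    have h := hst n hn
    have hn0 : (0 : ℝ) < n := by exact_mod_cast hK.trans_le hn
    have hα0 : 0 ≤ alpha β φ K n := ha₀.le.trans h.alpha_ge
    have hQ : avg n (fun i =>
        (scaledGamma β n * coord β φ K n i - alpha β φ K n * φ (i / n)) ^ 2)
        ≤ (|scaledGamma β n| * |D'| + a₁ * B) ^ 2 := by
      refine avg_le_const (sq_nonneg _) fun i i1 i2 => ?_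
      rw [← sq_abs]
      refine pow_le_pow_left₀ (abs_nonneg _) ((abs_sub _ _).trans ?_) 2
      rw [abs_mul, abs_mul, abs_of_nonneg hα0]
      exact add_le_add (mul_le_mul_of_nonneg_left (hD n i i1 i2) (abs_nonneg _))
        (mul_le_mul h.alpha_le (hφ.lipBdd.bound _ (div_mem_unit i2.le)) (abs_nonneg _)
          (hα0.trans h.alpha_le))
    have h1 := div_le_div_of_nonneg_right hQ hn0.le
    have h2 := h.xi_sq
    have h3 := h.xi_ge
    have h4 := h.xi_le
    nlinarith
  · filter_upwards [eventually_ge_atTop K] with n hn using (hst n hn).xi_le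

/-- The parameters `α_n` converge to `1`. -/
lemma tendsto_alpha (hβ0 : 0 < β) (hβ : β < 1 / 2) (hφ : IsCutoff φ δ B) (hK : 0 < K)
    (hA : 0 < ∫ x in (0 : ℝ)..1, φ x)
    (heq : ∫ x in (0 : ℝ)..1, φ x * profile φ x = β / (1 - 2 * β))
    (hst : ∀ n ≥ K, StepBounds β φ K a₀ a₁ n)
    (ha₀ : 0 < a₀) (hb : ∀ n ≥ K, scaledCoeffSucc β n ≤ 2 * √(1 - 2 * β)) :
    Tendsto (alpha β φ K) atTop (𝓝 1) := by
  have hs := sqrt_one_sub_pos hβ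
  have hs2 : √(1 - 2 * β) ^ 2 = 1 - 2 * β := Real.sq_sqrt (by linarith)
  obtain ⟨D, hD⟩ := exists_abs_coord_le hβ hφ hK hst ha₀ hb
  have hξ := tendsto_xi hβ hφ hK hst ha₀ hb
  have hbt := tendsto_scaledCoeffSucc hβ
  have hx := hbt.mul hξ
  rw [mul_one] at hx
  have h0 : (0 : ℝ) ∈ Set.Icc (0 : ℝ) 1 := by simp
  have h1 : (1 : ℝ) ∈ Set.Icc (0 : ℝ) 1 := by simp
  set s := √(1 - 2 * β) with hsdef
  set A := ∫ x in (0 : ℝ)..1, φ x with hAdef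
  set W := ∫ x in (0 : ℝ)..1, φ x * (profile φ x + -1) with hWdef
  have hW0 : 0 ≤ W := intervalIntegral.integral_nonneg zero_le_one fun x hx =>
    mul_nonneg (hφ.nonneg x hx) (by linarith [hφ.profile_one_le hx])
  have hAW : A + W = β / (1 - 2 * β) := by
    rw [← heq, hAdef, hWdef, ← intervalIntegral.integral_add
      (hφ.lipBdd.intervalIntegrable h0 h1)
      ((hφ.lipBdd.mul (hφ.lipBdd_profile.add (LipBdd.const (-1)))).intervalIntegrable h0 h1)]
    refine intervalIntegral.integral_congr fun x _ => ?_
    ring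
  -- The integral hypothesis enters here: the limit of `α_n T_n` is exactly the value of `T`
  -- predicted by `α = 1`.
  have hc : β / s = s * (A + W) := by
    rw [hAW, ← hs2]; field_simp
  have hev := eventually_ge_atTop K
  have hCt := scaledGamma_sub_scaledCoeff_tendsto hβ
  rw [← hsdef, hc] at hCt
  refine tendsto_one_of_contraction (T := fun n => avg n (fun i => φ (i / n) * coord β φ K n i))
    hs hA hW0 ha₀ (hev.mono fun n hn => (hst n hn).alpha_ge)
    (hev.mono fun n hn => (hst n hn).alpha_le) (hev.mono fun n hn => (hst n hn).avg_pos)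
    hCt (hev.mono fun n hn => (hst n hn).alpha_mul_avg) ?_ ?_
  · intro ρ hρ hα v hv
    obtain ⟨ε, hε, hεv⟩ : ∃ ε > 0, ε * (A + W) < v - s * (A + ρ * W) := by
      have hpos : 0 < A + W := by linarith
      refine ⟨(v - s * (A + ρ * W)) / (2 * (A + W)), div_pos (by linarith) (by linarith), ?_⟩
      have : (v - s * (A + ρ * W)) / (2 * (A + W)) * (A + W) = (v - s * (A + ρ * W)) / 2 := by
        field_simp
      linarith
    refine isVolterra_coord.eventually_avg_le hφ hD (κ₀ := s + ε) (κ₁ := s * ρ + ε)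
      (hx.eventually_le_const (by linarith)) ?_ ?_
    · have := (hbt.mul_const ρ).eventually_le_const (by linarith : s * ρ < s * ρ + ε)
      filter_upwards [this, hα, hev] with n h1 h2 h3
      exact (mul_le_mul_of_nonneg_left h2 (scaledCoeffSucc_pos hβ (hK.trans_le h3)).le).trans h1
    · rw [← hAdef, ← hWdef]; linarith
  · intro ρ hρ hα v hv
    obtain ⟨ε, hε, hεv⟩ : ∃ ε > 0, ε * (A + W) < s * (A + ρ * W) - v := by
      have hpos : 0 < A + W := by linarith
      refine ⟨(s * (A + ρ * W) - v) / (2 * (A + W)), div_pos (by linarith) (by linarith), ?_⟩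
      have : (s * (A + ρ * W) - v) / (2 * (A + W)) * (A + W) = (s * (A + ρ * W) - v) / 2 := by
        field_simp
      linarith
    refine isVolterra_coord.eventually_le_avg hφ hD (κ₀ := s - ε) (κ₁ := s * ρ - ε)
      (hx.eventually_const_le (by linarith)) ?_ ?_
    · have := (hbt.mul_const ρ).eventually_const_le (by linarith : s * ρ - ε < s * ρ)
      filter_upwards [this, hα, hev] with n h1 h2 h3
      exact h1.trans (mul_le_mul_of_nonneg_left h2 (scaledCoeffSucc_pos hβ (hK.trans_le h3)).le)
    · rw [← hAdef, ← hWdef]; linarith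

lemma isProfile_coord (hβ : β < 1 / 2) (hφ : IsCutoff φ δ B) {D : ℝ}
    (hD : ∀ n i, 1 ≤ i → i < n → |coord β φ K n i| ≤ D)
    (hξ : Tendsto (xi β φ K) atTop (𝓝 1)) (hα : Tendsto (alpha β φ K) atTop (𝓝 1)) :
    IsProfile (coord β φ K) (fun t => √(1 - 2 * β) * profile φ t) := by
  have hbt := tendsto_scaledCoeffSucc hβ
  have hx := hbt.mul hξ
  have hy := hbt.mul hα
  rw [mul_one] at hx hy
  exact isVolterra_coord.isProfile hφ hD hx hy

end

/-! ### Inner products of residuals with directions -/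

section
open Filter Topology

lemma LipBdd.sub {C D : ℝ} {f g : ℝ → ℝ} (hf : LipBdd C f) (hg : LipBdd D g) :
    LipBdd (C + D) (fun x => f x - g x) := by
  refine ⟨fun x hx => (abs_sub _ _).trans (add_le_add (hf.bound x hx) (hg.bound x hx)),
    fun x hx y hy => ?_⟩
  have e1 : f x - g x - (f y - g y) = (f x - f y) - (g x - g y) := by ring
  rw [e1, add_mul]
  exact (abs_sub _ _).trans (add_le_add (hf.lip x hx y hy) (hg.lip x hx y hy))

namespace IsProfile

variable {X Y : ℕ → ℕ → ℝ} {f g : ℝ → ℝ}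

lemma sub (hX : IsProfile X f) (hY : IsProfile Y g) :
    IsProfile (fun n i => X n i - Y n i) (fun x => f x - g x) := by
  obtain ⟨C, hC⟩ := hX.lipBdd
  obtain ⟨D, hD⟩ := hY.lipBdd
  obtain ⟨B, hB⟩ := hX.bdd
  obtain ⟨E, hE⟩ := hY.bdd
  refine ⟨⟨_, hC.sub hD⟩, ⟨B + E, fun n i a b =>
    (abs_sub _ _).trans (add_le_add (hB n i a b) (hE n i a b))⟩, fun ε hε => ?_⟩
  obtain ⟨M, hM⟩ := hX.conv (ε / 2) (half_pos hε)
  obtain ⟨M', hM'⟩ := hY.conv (ε / 2) (half_pos hε)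
  refine ⟨max M M', fun i hi n hn => ?_⟩
  have h1 := hM i ((le_max_left _ _).trans hi) n hn
  have h2 := hM' i ((le_max_right _ _).trans hi) n hn
  have e1 : X n i - Y n i - (f (i / n) - g (i / n))
    = (X n i - f (i / n)) - (Y n i - g (i / n)) := by ring
  rw [e1]
  linarith [abs_sub (X n i - f (i / n)) (Y n i - g (i / n))]

lemma mul (hX : IsProfile X f) (hY : IsProfile Y g) :
    IsProfile (fun n i => X n i * Y n i) (fun x => f x * g x) := by
  obtain ⟨C, hC⟩ := hX.lipBdd
  obtain ⟨D, hD⟩ := hY.lipBdd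
  obtain ⟨B, hB'⟩ := hX.bdd
  obtain ⟨E, hE'⟩ := hY.bdd
  have hB : ∀ n i, 1 ≤ i → i < n → |X n i| ≤ |B| := fun n i a b =>
    (hB' n i a b).trans (le_abs_self _)
  have hD0 := hD.nonneg
  refine ⟨⟨_, hC.mul hD⟩, ⟨|B| * E, fun n i a b => ?_⟩, fun ε hε => ?_⟩
  · rw [abs_mul]
    exact mul_le_mul (hB n i a b) (hE' n i a b) (abs_nonneg _) (abs_nonneg _)
  set η := ε / (|B| + D + 1) with hη
  have hη0 : 0 < η := by positivity
  obtain ⟨M, hM⟩ := hX.conv η hη0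
  obtain ⟨M', hM'⟩ := hY.conv η hη0
  refine ⟨max (max M M') 1, fun i hi n hn => ?_⟩
  have h1 := hM i ((le_max_left _ _).trans ((le_max_left _ _).trans hi)) n hn
  have h2 := hM' i ((le_max_right _ _).trans ((le_max_left _ _).trans hi)) n hn
  have h3 := hB n i ((le_max_right _ _).trans hi) hn
  have h4 := hD.bound _ (div_mem_unit (le_of_lt hn))
  have e1 : X n i * Y n i - f (i / n) * g (i / n)
    = X n i * (Y n i - g (i / n)) + (X n i - f (i / n)) * g (i / n) := by ring
  rw [e1]
  refine (abs_add_le _ _).trans ?_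
  rw [abs_mul, abs_mul]
  have h5 := mul_le_mul h3 h2 (abs_nonneg _) (abs_nonneg _)
  have h6 := mul_le_mul h1 h4 (abs_nonneg _) hη0.le
  have h7 : (|B| + D + 1) * η = ε := by rw [hη]; field_simp
  nlinarith

lemma of_tendsto_row {c : ℕ → ℝ} {l : ℝ} (hc : Tendsto c atTop (𝓝 l)) :
    IsProfile (fun n _ => c n) (fun _ => l) := by
  obtain ⟨B, hB⟩ := hc.abs.bddAbove_range
  refine ⟨⟨_, LipBdd.const l⟩, ⟨B, fun n _ _ _ => hB ⟨n, rfl⟩⟩, fun ε hε => ?_⟩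
  obtain ⟨M, hM⟩ := Metric.tendsto_atTop.1 hc ε hε
  exact ⟨M, fun i hi n hn => by
    simpa [Real.dist_eq] using (hM n (le_of_lt (lt_of_le_of_lt hi hn))).le⟩

lemma of_tendsto_col {c : ℕ → ℝ} {l : ℝ} (hc : Tendsto c atTop (𝓝 l)) :
    IsProfile (fun _ i => c i) (fun _ => l) := by
  obtain ⟨B, hB⟩ := hc.abs.bddAbove_range
  refine ⟨⟨_, LipBdd.const l⟩, ⟨B, fun _ i _ _ => hB ⟨i, rfl⟩⟩, fun ε hε => ?_⟩
  obtain ⟨M, hM⟩ := Metric.tendsto_atTop.1 hc ε hε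
  exact ⟨M, fun i hi n hn => by simpa [Real.dist_eq] using (hM i hi).le⟩

end IsProfile

/-- The limit profile `φ - (1 - β) Φ` of the coordinates of `n d_n`. -/
noncomputable def dirProfile (β : ℝ) (φ : ℝ → ℝ) (x : ℝ) : ℝ := φ x - (1 - β) * profile φ x

/-- The coordinates below `k` of `k d_k`. -/
noncomputable def dirLow (β : ℝ) (φ : ℝ → ℝ) (K k i : ℕ) : ℝ :=
  alpha β φ K k * φ (i / k) - scaledGamma β k * coord β φ K k i

/-- The coordinates of `d_k`. -/
noncomputable def dirCoord (β : ℝ) (φ : ℝ → ℝ) (K k i : ℕ) : ℝ :=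
  if i < k then dirLow β φ K k i / k else if i = k then xi β φ K k else 0

/-- The inner product of `-n^(1-β) r_{n-1}` and `d_k`. -/
noncomputable def dirDot (β : ℝ) (φ : ℝ → ℝ) (K n k : ℕ) : ℝ :=
  ∑ i ∈ Finset.Ico 1 n, coord β φ K n i * dirCoord β φ K k i

variable {β : ℝ} {φ : ℝ → ℝ} {K : ℕ} {δ B a₀ a₁ : ℝ}

/-- The limit `(1-β)/s` of the scaled `γ_k` cancels the factor `s` in the profile of the
coordinates. -/
lemma isProfile_dirLow (hβ : β < 1 / 2) (hφ : IsCutoff φ δ B)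
    (hU : IsProfile (coord β φ K) (fun t => √(1 - 2 * β) * profile φ t))
    (hα : Tendsto (alpha β φ K) atTop (𝓝 1)) :
    IsProfile (dirLow β φ K) (dirProfile β φ) := by
  have h := ((IsProfile.of_tendsto_row hα).mul (IsProfile.of_lipBdd hφ.lipBdd)).sub
    ((IsProfile.of_tendsto_row (tendsto_scaledGamma hβ)).mul hU)
  have hs := sqrt_one_sub_pos hβ
  have e : dirProfile β φ = fun x => 1 * φ x
      - (1 - β) / √(1 - 2 * β) * (√(1 - 2 * β) * profile φ x) := by
    ext x
    rw [dirProfile, ← mul_assoc, div_mul_cancel₀ _ hs.ne', one_mul]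
  rw [e]
  exact h

lemma dirDot_of_le {n k : ℕ} (h : n ≤ k) (hn : 0 < n) :
    dirDot β φ K n k = n / k * avg n (fun i => coord β φ K n i * dirLow β φ K k i) := by
  have hn' : (n : ℝ) ≠ 0 := by exact_mod_cast hn.ne'
  rw [avg, div_mul_div_comm, mul_comm (k : ℝ), mul_div_mul_left _ _ hn', Finset.sum_div, dirDot]
  refine Finset.sum_congr rfl fun i hi => ?_
  rw [dirCoord, if_pos ((Finset.mem_Ico.1 hi).2.trans_le h), mul_div_assoc]

lemma dirDot_of_lt {n k : ℕ} (h : k < n) (hk : 0 < k) :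
    dirDot β φ K n k = avg k (fun i => dirLow β φ K k i * coord β φ K n i)
      + xi β φ K k * coord β φ K n k := by
  rw [dirDot, ← Finset.sum_Ico_consecutive _ (hk : 1 ≤ k) h.le, Finset.sum_eq_sum_Ico_succ_bot h]
  have h1 : ∑ i ∈ Finset.Ico (k + 1) n, coord β φ K n i * dirCoord β φ K k i = 0 :=
    Finset.sum_eq_zero fun i hi => by
      have := (Finset.mem_Ico.1 hi).1
      rw [dirCoord, if_neg (by omega), if_neg (by omega), mul_zero]
  rw [h1, add_zero, avg, Finset.sum_div]
  congr 1
  · refine Finset.sum_congr rfl fun i hi => ?_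
    rw [dirCoord, if_pos (Finset.mem_Ico.1 hi).2]
    ring
  · rw [dirCoord, if_neg (lt_irrefl _), if_pos rfl, mul_comm]

lemma dirDot_self {k : ℕ} (hk : 0 < k) (h : StepBounds β φ K a₀ a₁ k)
    (hsq : ∑ i ∈ Finset.Ico 1 k, coord β φ K k i ^ 2 = k) :
    dirDot β φ K k k = - scaledCoeff β k := by
  have hk' : (k : ℝ) ≠ 0 := by exact_mod_cast hk.ne'
  rw [dirDot_of_le le_rfl hk, div_self hk', one_mul]
  have e : (fun i : ℕ => coord β φ K k i * dirLow β φ K k i)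
      = fun i : ℕ => alpha β φ K k * (φ (i / k) * coord β φ K k i)
        - scaledGamma β k * coord β φ K k i ^ 2 := by
    ext i; rw [dirLow]; ring
  rw [e, avg_sub, avg_const_mul, avg_const_mul k _ (fun i => coord β φ K k i ^ 2),
    avg_coord_sq hk hsq, h.alpha_mul_avg]
  ring

/-- Raising the residual index adds the increments below `n` and the new coordinate `n`; for `n < k`
both meet only the low coordinates of `d_k`. -/
lemma dirDot_succ {n k : ℕ} (hKn : K ≤ n) (hn : 0 < n) (hnk : n < k) :
    n * dirDot β φ K (n + 1) k = n * dirDot β φ K n k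
      + n / k * (avg n (fun i => scaledCoeffSucc β n * alpha β φ K n * φ (i / n)
          * dirLow β φ K k i)
        + scaledCoeffSucc β n * xi β φ K n * dirLow β φ K k n) := by
  have hn' : (n : ℝ) ≠ 0 := by exact_mod_cast hn.ne'
  have e1 : ∑ i ∈ Finset.Ico 1 n, coord β φ K (n + 1) i * dirCoord β φ K k i
      = dirDot β φ K n k + 1 / k * avg n (fun i => scaledCoeffSucc β n * alpha β φ K n * φ (i / n)
          * dirLow β φ K k i) := by
    rw [dirDot, avg, Finset.sum_div, Finset.mul_sum, ← Finset.sum_add_distrib]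
    refine Finset.sum_congr rfl fun i hi => ?_
    have hi' := (Finset.mem_Ico.1 hi).2
    rw [coord_succ_of_lt hKn hi', dirCoord, if_pos (hi'.trans hnk)]
    ring
  rw [dirDot, Finset.sum_Ico_succ_top hn, e1, coord_succ_self hKn, dirCoord, if_pos hnk]
  ring

/-- `|⟪r_{n-1}, d_k⟫| ≤ c q_n` for `k < n`, uniformly for large `k`. -/
lemma exists_abs_dirDot_le (hβ : β < 1 / 2) (hφ : IsCutoff φ δ B)
    (hU : IsProfile (coord β φ K) (fun t => √(1 - 2 * β) * profile φ t))
    (hα : Tendsto (alpha β φ K) atTop (𝓝 1)) (hξ : Tendsto (xi β φ K) atTop (𝓝 1))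
    {c : ℝ} (hc : c < 1)
    (hsup : ∀ a ∈ Set.Icc (0 : ℝ) 1,
      |(∫ x in (0 : ℝ)..1, dirProfile β φ x * profile φ (a * x)) + profile φ a| ≤ c) :
    ∃ c' < (1 : ℝ), ∃ N : ℕ, ∀ k ≥ N, ∀ n > k,
      |dirDot β φ K n k| ≤ c' * scaledCoeff β n := by
  have hs := sqrt_one_sub_pos hβ
  set s := √(1 - 2 * β) with hsdef
  have hD := isProfile_dirLow hβ hφ hU hα
  have hV := (IsProfile.of_tendsto_col hξ).mul hU
  -- The gap from `c` to `c₁` absorbs the error of the limits, and that from `c₁` to `c'` the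
  -- difference between `scaledCoeff β n` and its limit `s`.
  obtain ⟨c₁, hc₁, hc₁'⟩ := exists_between hc
  obtain ⟨c', hc', hc'1⟩ := exists_between hc₁'
  have hη : 0 < s * (c₁ - c) / 2 := by
    have := sub_pos.2 hc₁
    positivity
  obtain ⟨N₁, hN₁⟩ := hD.avg_mul hU hη
  obtain ⟨N₂, hN₂⟩ := hV.conv _ hη
  have hev := ((tendsto_scaledCoeff hβ).const_mul c').eventually_const_le
    (u := s * c₁) (by rw [mul_comm]; exact mul_lt_mul_of_pos_right hc' hs)
  obtain ⟨N₃, hN₃⟩ := hev.exists_forall_of_atTop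
  refine ⟨c', hc'1, max (max N₁ N₂) (max N₃ 1), fun k hk n hn => ?_⟩
  have hk1 : N₁ ≤ k := (le_max_left _ _).trans ((le_max_left _ _).trans hk)
  have hk2 : N₂ ≤ k := (le_max_right _ _).trans ((le_max_left _ _).trans hk)
  have hk3 : N₃ ≤ k := (le_max_left _ _).trans ((le_max_right _ _).trans hk)
  have hk4 : 1 ≤ k := (le_max_right _ _).trans ((le_max_right _ _).trans hk)
  have hn' : k < n := hn
  have h1 := hN₁ k hk1 n hn'.le
  have h2 := hN₂ k hk2 n hn'
  have h3 := hN₃ n (hk3.trans hn'.le)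
  have h4 := hsup _ (div_mem_unit hn'.le)
  rw [dirDot_of_lt hn' hk4]
  have e1 : ∫ x in (0 : ℝ)..1, dirProfile β φ x * (s * profile φ ((k : ℝ) / n * x))
      = s * ∫ x in (0 : ℝ)..1, dirProfile β φ x * profile φ ((k : ℝ) / n * x) := by
    rw [← intervalIntegral.integral_const_mul]
    refine intervalIntegral.integral_congr fun x _ => ?_
    ring
  rw [e1] at h1
  rw [one_mul] at h2
  rw [abs_le] at h1 h2 h4
  have h5 := mul_le_mul_of_nonneg_left h4.1 hs.le
  have h6 := mul_le_mul_of_nonneg_left h4.2 hs.le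
  refine le_trans ?_ h3
  rw [abs_le]
  constructor <;> linarith [h1.1, h1.2, h2.1, h2.2]

/-- `|⟪r_{n-1}, d_k⟫| < q_n` for `n < k`, uniformly for large `n`. -/
lemma exists_abs_dirDot_lt (hβ0 : 0 < β) (hβ : β < 1 / 2) (hφ : IsCutoff φ δ B)
    (hst : ∀ n ≥ K, StepBounds β φ K a₀ a₁ n)
    (hsq : ∀ n ≥ K, ∑ i ∈ Finset.Ico 1 n, coord β φ K n i ^ 2 = n)
    (hU : IsProfile (coord β φ K) (fun t => √(1 - 2 * β) * profile φ t))
    (hα : Tendsto (alpha β φ K) atTop (𝓝 1)) (hξ : Tendsto (xi β φ K) atTop (𝓝 1))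
    {c : ℝ} (hc : c < 1)
    (hsup : ∀ a ∈ Set.Ioc (0 : ℝ) 1,
      |a * (dirProfile β φ a + (∫ x in (0 : ℝ)..1, φ x * dirProfile β φ (a * x))
        - ∫ x in (0 : ℝ)..1, profile φ x * dirProfile β φ (a * x))| ≤ c) :
    ∃ N : ℕ, ∀ n ≥ N, ∀ k > n, |dirDot β φ K n k| < scaledCoeff β n := by
  have hs := sqrt_one_sub_pos hβ
  set s := √(1 - 2 * β) with hsdef
  have hD := isProfile_dirLow hβ hφ hU hα
  have hbt := tendsto_scaledCoeffSucc hβ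
  have hZ := (IsProfile.of_tendsto_row (hbt.mul hα)).mul (IsProfile.of_lipBdd hφ.lipBdd)
  have hY := (IsProfile.of_tendsto_col (hbt.mul hξ)).mul hD
  obtain ⟨c₁, hc₁, hc₁'⟩ := exists_between hc
  have hη : 0 < s * (c₁ - c) / 3 := by
    have := sub_pos.2 hc₁
    positivity
  obtain ⟨N₁, hN₁⟩ := hU.avg_mul hD hη
  obtain ⟨N₂, hN₂⟩ := hZ.avg_mul hD hη
  obtain ⟨N₃, hN₃⟩ := hY.conv _ hη
  have hst0 := tendsto_scaledCoeff hβ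
  have hev : ∀ᶠ n : ℕ in atTop, 0 < scaledCoeff β n - scaledCoeff β n / n - s * c₁ := by
    have := (hst0.sub (hst0.div_atTop tendsto_natCast_atTop_atTop)).sub_const (s * c₁)
    exact this.eventually_const_lt (by nlinarith)
  obtain ⟨N₄, hN₄⟩ := hev.exists_forall_of_atTop
  -- The downward step: a weak bound at `n + 1` yields a strict bound at `n`.
  have main : ∀ n ≥ max (max N₁ N₂) (max (max N₃ N₄) (max K 1)), ∀ k > n,
      |dirDot β φ K (n + 1) k| ≤ scaledCoeff β (n + 1) →
      |dirDot β φ K n k| < scaledCoeff β n := by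
    intro n hn k hk hle
    simp only [ge_iff_le, max_le_iff] at hn
    obtain ⟨⟨hn1, hn2⟩, ⟨hn3, hn4⟩, hnK, hn0⟩ := hn
    have hnk : n < k := hk
    have hn' : (0 : ℝ) < n := by exact_mod_cast hn0
    have hk' : (0 : ℝ) < k := hn'.trans (by exact_mod_cast hnk)
    have h1 := hN₁ n hn1 k hnk.le
    have h2 := hN₂ n hn2 k hnk.le
    have h3 := hN₃ n hn3 k hk
    have h4 := hN₄ n hn4
    have hmem := div_mem_unit hnk.le
    set a : ℝ := (n : ℝ) / k with ha
    have ha0 : 0 < a := by positivity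
    have h5 := hsup a ⟨ha0, hmem.2⟩
    have e1 : ∫ x in (0 : ℝ)..1, s * profile φ x * dirProfile β φ (a * x)
        = s * ∫ x in (0 : ℝ)..1, profile φ x * dirProfile β φ (a * x) := by
      rw [← intervalIntegral.integral_const_mul]
      refine intervalIntegral.integral_congr fun x _ => ?_
      ring
    have e2 : ∫ x in (0 : ℝ)..1, s * 1 * φ x * dirProfile β φ (a * x)
        = s * ∫ x in (0 : ℝ)..1, φ x * dirProfile β φ (a * x) := by
      rw [← intervalIntegral.integral_const_mul]
      refine intervalIntegral.integral_congr fun x _ => ?_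
      ring
    rw [e1] at h1
    rw [e2] at h2
    rw [mul_one] at h3
    have d1 := dirDot_of_le (β := β) (φ := φ) (K := K) hnk.le hn0
    have d2 := dirDot_succ (β := β) (φ := φ) hnK hn0 hnk
    rw [← ha] at d1 d2
    set P := dirDot β φ K n k
    set P' := dirDot β φ K (n + 1) k
    set u := avg n (fun i => coord β φ K n i * dirLow β φ K k i)
    set v := avg n (fun i => scaledCoeffSucc β n * alpha β φ K n * φ (i / n) * dirLow β φ K k i)
    set w := scaledCoeffSucc β n * xi β φ K n * dirLow β φ K k n
    set I := ∫ x in (0 : ℝ)..1, profile φ x * dirProfile β φ (a * x)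
    set J := ∫ x in (0 : ℝ)..1, φ x * dirProfile β φ (a * x)
    set H := dirProfile β φ a
    have b1 : |(v + w - u) - s * (H + J - I)| ≤ s * (c₁ - c) := by
      rw [abs_le] at h1 h2 h3 ⊢
      constructor <;> linarith [h1.1, h1.2, h2.1, h2.2, h3.1, h3.2]
    have b2 : |a * ((v + w - u) - s * (H + J - I))| ≤ s * (c₁ - c) := by
      rw [abs_mul, abs_of_pos ha0]
      exact (mul_le_of_le_one_left (abs_nonneg _) hmem.2).trans b1
    have b3 : |a * (v + w - u)| ≤ s * c₁ := by
      have e3 : a * (v + w - u) = a * ((v + w - u) - s * (H + J - I)) + s * (a * (H + J - I)) := by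
        ring
      rw [e3]
      refine (abs_add_le _ _).trans ?_
      rw [abs_mul s, abs_of_pos hs]
      have := mul_le_mul_of_nonneg_left h5 hs.le
      linarith
    -- Adding one copy of `P = a u` produces the weight `n + 1` on the left and the combination
    -- whose limit is bounded by the first supremum condition.
    have b4 : (n + 1) * P = n * P' - a * (v + w - u) := by
      rw [d2]
      linear_combination d1
    have b5 : (n + 1) * |P| ≤ n * |P'| + s * c₁ := by
      have e4 : (n + 1 : ℝ) * |P| = |n * P' - a * (v + w - u)| := by
        rw [← b4, abs_mul, abs_of_pos (by linarith : (0 : ℝ) < n + 1)]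
      rw [e4]
      refine (abs_sub _ _).trans ?_
      rw [abs_mul, abs_of_pos hn']
      linarith
    have b6 := hle.trans (scaledCoeff_succ_le hβ0 hβ hn0)
    have b7 := mul_le_mul_of_nonneg_left b6 hn'.le
    have b8 : (n : ℝ) * (scaledCoeff β n * (1 + 1 / (n : ℝ) ^ 2))
        = n * scaledCoeff β n + scaledCoeff β n / n := by
      field_simp
    -- The weights leave one spare copy of the scaled coefficient, which beats `s c₁` plus the
    -- monotonicity defect `scaledCoeff β n / n`.
    have b9 : (n + 1 : ℝ) * |P| < (n + 1) * scaledCoeff β n := by linarith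
    exact lt_of_mul_lt_mul_left b9 (by linarith)
  set N := max (max N₁ N₂) (max (max N₃ N₄) (max K 1)) with hN
  have hNK : K ≤ N := (le_max_left _ _).trans ((le_max_right _ _).trans (le_max_right _ _))
  have hN1 : 1 ≤ N := (le_max_right _ _).trans ((le_max_right _ _).trans (le_max_right _ _))
  -- Induction on the distance `j = k - n`. At `j = 0` equality holds, hence the weak inequality.
  have down : ∀ j : ℕ, ∀ n ≥ N, |dirDot β φ K n (n + j)| ≤ scaledCoeff β n := by
    intro j
    induction j with
    | zero =>
      intro n hn
      have hn0 : 0 < n := hN1.trans hn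
      rw [add_zero, dirDot_self hn0 (hst n (hNK.trans hn)) (hsq n (hNK.trans hn)), abs_neg,
        abs_of_pos (scaledCoeff_pos hβ hn0)]
    | succ j ih =>
      intro n hn
      refine (main n hn _ (by omega) ?_).le
      have := ih (n + 1) (by omega)
      rwa [show n + 1 + j = n + (j + 1) by ring] at this
  refine ⟨N, fun n hn k hk => main n hn k hk ?_⟩
  have := down (k - (n + 1)) (n + 1) (by omega)
  rwa [show n + 1 + (k - (n + 1)) = k by have : n < k := hk; omega] at this

end

/-! ### Return to `ℓ²` and the perturbed dictionary -/

section
open Filter Topology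

lemma inner_e {i j : ℕ} (hi : 1 ≤ i) (hj : 1 ≤ j) :
    inner ℝ (e i) (e j) = if i = j then (1 : ℝ) else 0 := by
  rw [e, e, lp.inner_single_left, lp.single_apply]
  by_cases h : i = j
  · subst h; simp
  · rw [if_neg h, Pi.single_eq_of_ne (by omega)]
    simp

lemma inner_sum_e (f g : ℕ → ℝ) {m n : ℕ} :
    inner ℝ (∑ i ∈ Finset.Ico 1 m, f i • e i) (∑ j ∈ Finset.Ico 1 n, g j • e j)
      = ∑ i ∈ Finset.Ico 1 m, f i * (if i < n then g i else 0) := by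
  rw [sum_inner]
  refine Finset.sum_congr rfl fun i hi => ?_
  have hi1 := (Finset.mem_Ico.1 hi).1
  rw [inner_sum]
  have : ∀ j ∈ Finset.Ico 1 n, inner ℝ (f i • e i) (g j • e j)
      = if i = j then f i * g j else 0 := fun j hj => by
    rw [real_inner_smul_left, real_inner_smul_right, inner_e hi1 (Finset.mem_Ico.1 hj).1]
    split_ifs <;> simp
  rw [Finset.sum_congr rfl this, Finset.sum_ite_eq]
  by_cases h : i < n
  · rw [if_pos (Finset.mem_Ico.2 ⟨hi1, h⟩), if_pos h]
  · rw [if_neg (by simp [h]), if_neg h, mul_zero]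

/-- The residual `r_n`. -/
noncomputable def resid (β : ℝ) (φ : ℝ → ℝ) (K n : ℕ) : ell2 :=
  -(((n : ℝ) + 1) ^ (β - 1)) • ∑ i ∈ Finset.Ico 1 (n + 1), coord β φ K (n + 1) i • e i

/-- The direction `d_n`. -/
noncomputable def dir (β : ℝ) (φ : ℝ → ℝ) (K n : ℕ) : ell2 :=
  ∑ i ∈ Finset.Ico 1 (n + 1), dirCoord β φ K n i • e i

variable {β : ℝ} {φ : ℝ → ℝ} {K : ℕ} {δ B a₀ a₁ : ℝ}

lemma resid_pred {n : ℕ} (hn : 0 < n) :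
    resid β φ K (n - 1)
      = -((n : ℝ) ^ (β - 1)) • ∑ i ∈ Finset.Ico 1 n, coord β φ K n i • e i := by
  obtain ⟨m, rfl⟩ := Nat.exists_eq_succ_of_ne_zero hn.ne'
  simp [resid]

lemma inner_resid_dir {n k : ℕ} (hn : 0 < n) :
    inner ℝ (resid β φ K (n - 1)) (dir β φ K k) = -((n : ℝ) ^ (β - 1)) * dirDot β φ K n k := by
  rw [resid_pred hn, dir, real_inner_smul_left, inner_sum_e, dirDot]
  congr 1
  refine Finset.sum_congr rfl fun i _ => ?_
  by_cases h : i < k + 1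
  · rw [if_pos h]
  · rw [if_neg h, dirCoord, if_neg (by omega), if_neg (by omega)]

lemma greedyCoeff_eq {n : ℕ} (hn : 0 < n) :
    greedyCoeff β n = (n : ℝ) ^ (β - 1) * scaledCoeff β n := by
  have hn' : (0 : ℝ) < n := by exact_mod_cast hn
  rw [scaledCoeff, ← mul_assoc, ← Real.rpow_add hn']
  simp

lemma greedyCoeff_eq_succ {n : ℕ} :
    greedyCoeff β n = ((n : ℝ) + 1) ^ (β - 1) * scaledCoeffSucc β n := by
  rw [scaledCoeffSucc, ← mul_assoc, ← Real.rpow_add (by positivity)]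
  simp

/-- Expresses the choice of `γ_n`: subtracting the multiple of `r_{n-1}` contained in `q_n d_n`
replaces the prefactor `n^(β-1)` by `(n+1)^(β-1)`. -/
lemma greedyCoeff_mul_scaledGamma (hβ : β < 1 / 2) {n : ℕ} (hn : 0 < n) :
    greedyCoeff β n * scaledGamma β n / n = (n : ℝ) ^ (β - 1) - ((n : ℝ) + 1) ^ (β - 1) := by
  have hn' : (0 : ℝ) < n := by exact_mod_cast hn
  have hs := (scaledCoeff_pos hβ hn).ne'
  have hp := (Real.rpow_pos_of_pos hn' (β - 1)).ne'
  rw [greedyCoeff_eq hn, scaledGamma, neg_sub, Real.div_rpow (by positivity) hn'.le]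
  field_simp

lemma isIteration (hβ : β < 1 / 2) (hK : 1 < K) :
    IsIteration β φ K (fun n => scaledGamma β n * (n : ℝ) ^ (-β)) (xi β φ K) (alpha β φ K)
      (greedyCoeff β) (resid β φ K) (dir β φ K) where
  init := by
    have hK0 : (0 : ℝ) < K := by exact_mod_cast (by omega : 0 < K)
    have hI : Finset.Icc 1 (K - 1) = Finset.Ico 1 K := by
      ext i; simp only [Finset.mem_Icc, Finset.mem_Ico]; omega
    rw [resid_pred (by omega), hI]
    simp only [coord_of_le le_rfl, ← Finset.smul_sum, smul_smul, ← neg_smul]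
    congr 1
    have : (K : ℝ) ^ (-1 / 2 + β) = (K : ℝ) ^ (β - 1) * √K := by
      rw [Real.sqrt_eq_rpow, ← Real.rpow_add hK0]
      congr 1; ring
    rw [this, Real.sqrt_div hK0.le]
    ring
  direction := fun n hn => by
    have hn0 : 0 < n := by omega
    have hn' : (0 : ℝ) < n := by exact_mod_cast hn0
    have hI : Finset.Icc 1 (n - 1) = Finset.Ico 1 n := by
      ext i; simp only [Finset.mem_Icc, Finset.mem_Ico]; omega
    have hp : (n : ℝ) ^ (-β) * (n : ℝ) ^ (β - 1) = (n : ℝ)⁻¹ := by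
      rw [← Real.rpow_add hn', ← Real.rpow_neg_one]
      congr 1; ring
    rw [resid_pred hn0, dir, h, hI, Finset.sum_Ico_succ_top hn0, dirCoord, if_neg (lt_irrefl _),
      if_pos rfl, smul_smul, Finset.smul_sum, ← Finset.sum_add_distrib]
    congr 1
    refine Finset.sum_congr rfl fun i hi => ?_
    rw [smul_smul, ← add_smul, dirCoord, if_pos (Finset.mem_Ico.1 hi).2, dirLow]
    congr 1
    rw [mul_neg, mul_assoc (scaledGamma β n), hp]
    ring
  residual := fun n hn => by
    have hn0 : 0 < n := by omega
    have hg := greedyCoeff_mul_scaledGamma hβ hn0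
    have hq := greedyCoeff_eq_succ (β := β) (n := n)
    rw [resid_pred hn0, resid, dir, Finset.sum_Ico_succ_top hn0, Finset.sum_Ico_succ_top hn0,
      smul_add, smul_add, ← sub_sub, Finset.smul_sum, Finset.smul_sum, Finset.smul_sum,
      ← Finset.sum_sub_distrib, sub_eq_add_neg _ (greedyCoeff β n • dirCoord β φ K n n • e n)]
    congr 1
    · refine Finset.sum_congr rfl fun i hi => ?_
      have hi' := (Finset.mem_Ico.1 hi).2
      rw [smul_smul, smul_smul, smul_smul, ← sub_smul, coord_succ_of_lt hn hi', dirCoord,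
        if_pos hi', dirLow]
      congr 1
      linear_combination (alpha β φ K n * (φ (i / n) / n)) * hq - coord β φ K n i * hg
    · rw [smul_smul, smul_smul, ← neg_smul, coord_succ_self hn, dirCoord, if_neg (lt_irrefl _),
        if_pos rfl, hq]
      congr 1
      ring

lemma isAdmissible (hK : 1 < K)
    (hst : ∀ n ≥ K, StepBounds β φ K a₀ a₁ n)
    (hsq : ∀ n ≥ K, ∑ i ∈ Finset.Ico 1 n, coord β φ K n i ^ 2 = n) :
    IsAdmissible β K (greedyCoeff β) (resid β φ K) (dir β φ K) where
  norm_residual := fun n hn => by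
    have h1 : ‖resid β φ K n‖ ^ 2 = ((((n : ℝ) + 1) ^ (-1 / 2 + β : ℝ))) ^ 2 := by
      rw [← real_inner_self_eq_norm_sq, resid, real_inner_smul_left, real_inner_smul_right,
        inner_sum_e]
      have e1 : ∑ i ∈ Finset.Ico 1 (n + 1), coord β φ K (n + 1) i *
          (if i < n + 1 then coord β φ K (n + 1) i else 0) = (n : ℝ) + 1 := by
        have := hsq (n + 1) (by omega)
        push_cast at this
        rw [← this]
        refine Finset.sum_congr rfl fun i hi => ?_
        rw [if_pos (Finset.mem_Ico.1 hi).2, sq]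
      have hp : (0 : ℝ) < n + 1 := by positivity
      have e2 : (((n : ℝ) + 1) ^ (-1 / 2 + β : ℝ)) = ((n : ℝ) + 1) ^ (β - 1) * √(n + 1) := by
        rw [Real.sqrt_eq_rpow, ← Real.rpow_add hp]
        congr 1; ring
      rw [e1, e2, mul_pow, Real.sq_sqrt hp.le]
      ring
    exact (pow_left_inj₀ (norm_nonneg _) (by positivity) two_ne_zero).1 h1
  coeff := fun n hn => by
    have hn0 : 0 < n := by omega
    rw [inner_resid_dir hn0, dirDot_self hn0 (hst n hn) (hsq n hn), greedyCoeff_eq hn0]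
    ring
  norm_direction := fun n hn => by
    have hn0 : 0 < n := by omega
    have hn' : (n : ℝ) ≠ 0 := by exact_mod_cast hn0.ne'
    have h1 : ‖dir β φ K n‖ ^ 2 = 1 ^ 2 := by
      rw [← real_inner_self_eq_norm_sq, dir, inner_sum_e, Finset.sum_Ico_succ_top hn0,
        if_pos n.lt_succ_self]
      have e1 : ∑ i ∈ Finset.Ico 1 n, dirCoord β φ K n i *
          (if i < n + 1 then dirCoord β φ K n i else 0)
          = avg n (fun i =>
            (scaledGamma β n * coord β φ K n i - alpha β φ K n * φ (i / n)) ^ 2) / n := by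
        rw [avg, Finset.sum_div, Finset.sum_div]
        refine Finset.sum_congr rfl fun i hi => ?_
        have hi' := (Finset.mem_Ico.1 hi).2
        rw [if_pos (by omega), dirCoord, if_pos hi', dirLow]
        field_simp
        ring
      have e2 : dirCoord β φ K n n = xi β φ K n := by
        rw [dirCoord, if_neg (lt_irrefl _), if_pos rfl]
      rw [e1, e2]
      have := (hst n hn).xi_sq
      linarith
    exact (pow_left_inj₀ (norm_nonneg _) zero_le_one two_ne_zero).1 h1

/-- A uniform bound for the inner products of the residuals with a fixed residual. -/
lemma exists_abs_inner_resid_le {D : ℝ}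
    (hD : ∀ n i, 1 ≤ i → i < n → |coord β φ K n i| ≤ D) (N : ℕ) :
    ∃ C, 0 ≤ C ∧ ∀ n > N,
      |inner ℝ (resid β φ K (n - 1)) (resid β φ K N)| ≤ C * (n : ℝ) ^ (β - 1) := by
  set A := ((N : ℝ) + 1) ^ (β - 1) with hA
  have hA0 : 0 ≤ A := by positivity
  refine ⟨A * (N * (|D| * |D|)), by positivity, fun n hn => ?_⟩
  have hn' : N < n := hn
  have hn0 : 0 < n := by omega
  rw [real_inner_comm, resid_pred hn0, resid, real_inner_smul_left, real_inner_smul_right,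
    inner_sum_e, abs_mul, abs_mul, abs_neg, abs_neg, ← hA, abs_of_nonneg hA0,
    abs_of_nonneg (by positivity : (0 : ℝ) ≤ (n : ℝ) ^ (β - 1))]
  -- Only the first `N` coordinates overlap, so the sum stays bounded as `n` grows and the decay is
  -- that of the prefactor, the same order as `q_n`.
  have h1 : |∑ i ∈ Finset.Ico 1 (N + 1), coord β φ K (N + 1) i *
      (if i < n then coord β φ K n i else 0)| ≤ N * (|D| * |D|) := by
    refine (Finset.abs_sum_le_sum_abs _ _).trans ?_
    have : ∀ i ∈ Finset.Ico 1 (N + 1), |coord β φ K (N + 1) i *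
        (if i < n then coord β φ K n i else 0)| ≤ |D| * |D| := fun i hi => by
      obtain ⟨i1, i2⟩ := Finset.mem_Ico.1 hi
      rw [if_pos (by omega), abs_mul]
      exact mul_le_mul ((hD _ _ i1 i2).trans (le_abs_self _))
        ((hD _ _ i1 (by omega)).trans (le_abs_self _)) (abs_nonneg _) (abs_nonneg _)
    refine (Finset.sum_le_sum this).trans (le_of_eq ?_)
    simp
  have h2 := mul_le_mul_of_nonneg_left h1 (by positivity : (0 : ℝ) ≤ (n : ℝ) ^ (β - 1))
  have h3 := mul_le_mul_of_nonneg_left h2 hA0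
  linarith

/-- The perturbed dictionary realizes the iteration as a pure greedy algorithm. -/
lemma exists_dictionary_run {q : ℕ → ℝ} {r d : ℕ → ell2} {N : ℕ}
    (hres : ∀ n > N, r n = r (n - 1) - q n • d n)
    (hq : ∀ n > N, 0 < q n) (hco : ∀ n > N, q n = inner ℝ (r (n - 1)) (d n))
    (hd : ∀ n ≥ N, ‖d n‖ = 1) (hr : 0 < ‖r N‖) (horth : inner ℝ (r N) (d N) = (0 : ℝ))
    {c C : ℝ} (hc : c < 1) (hC : 0 ≤ C)
    (hdN : ∀ n > N, |inner ℝ (r (n - 1)) (d N)| ≤ c * q n)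
    (hrN : ∀ n > N, |inner ℝ (r (n - 1)) (r N)| ≤ C * q n)
    (hdk : ∀ n > N, ∀ k ≥ N, k ≠ n → |inner ℝ (r (n - 1)) (d k)| < q n) :
    ∃ ε₀ : ℝ, 0 < ε₀ ∧ ε₀ ≤ 1 ∧ ∀ ε : ℝ, 0 < ε → ε < ε₀ →
      (∀ n > N,
        |inner ℝ (r (n - 1)) (dTilde r d N ε)| < q n ∧
        ∀ k ≥ N, k ≠ n → |inner ℝ (r (n - 1)) (d k)| < q n) ∧
      IsDictionary (dictionary r d N ε) ∧
      IsPureGreedyRun (dictionary r d N ε) (r N)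
        (fun m => r (N + m)) (fun m => d (N + m)) := by
  have hc1 : 0 < 1 - c := by linarith
  set C' := C / ‖r N‖ with hC'
  have hC'0 : 0 ≤ C' := by positivity
  -- The product with the perturbed vector is at most `(ε C' + c) q_n`, which must stay below `q_n`.
  refine ⟨min 1 ((1 - c) / (C' + 1)), lt_min one_pos (by positivity), min_le_left _ _,
    fun ε hε hε' => ?_⟩
  have hε1 : ε < 1 := hε'.trans_le (min_le_left _ _)
  have hε2 : ε * (C' + 1) < 1 - c := by
    rw [← lt_div_iff₀ (by positivity)]; exact hε'.trans_le (min_le_right _ _)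
  have hS0 : 0 ≤ √(1 - ε ^ 2) := Real.sqrt_nonneg _
  have hS1 : √(1 - ε ^ 2) ≤ 1 := Real.sqrt_le_iff.2 ⟨zero_le_one, by nlinarith⟩
  have hSsq : √(1 - ε ^ 2) ^ 2 = 1 - ε ^ 2 := Real.sq_sqrt (by nlinarith)
  have htilde : ∀ n > N, |inner ℝ (r (n - 1)) (dTilde r d N ε)| < q n := by
    intro n hn
    rw [dTilde, inner_add_right, real_inner_smul_right, real_inner_smul_right]
    refine (abs_add_le _ _).trans_lt ?_
    rw [abs_mul, abs_mul, abs_of_nonneg hS0, abs_of_pos (div_pos hε hr)]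
    have h1 := mul_le_mul_of_nonneg_left (hrN n hn) (div_pos hε hr).le
    have h2 : ε / ‖r N‖ * (C * q n) = ε * C' * q n := by rw [hC']; ring
    have h3 := (mul_le_of_le_one_left (abs_nonneg _) hS1).trans (hdN n hn)
    have h4 : (ε * C' + c) * q n < 1 * q n :=
      mul_lt_mul_of_pos_right (by linarith) (hq n hn)
    linarith
  -- Orthogonality of `r_N` and `d_N` makes this Pythagoras for unit vectors with weights `ε` and
  -- `√(1-ε²)`.
  have hnorm : ‖dTilde r d N ε‖ = 1 := by
    have h1 : ‖dTilde r d N ε‖ ^ 2 = 1 ^ 2 := by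
      rw [dTilde, norm_add_sq_real, real_inner_smul_left, real_inner_smul_right, horth,
        norm_smul, norm_smul, hd N le_rfl, Real.norm_of_nonneg (div_pos hε hr).le,
        div_mul_cancel₀ _ hr.ne', Real.norm_of_nonneg hS0, mul_one, hSsq]
      ring
    exact (pow_left_inj₀ (norm_nonneg _) zero_le_one two_ne_zero).1 h1
  refine ⟨fun n hn => ⟨htilde n hn, hdk n hn⟩, ⟨?_, ?_⟩, rfl, fun m => ⟨?_, ?_, ?_⟩⟩
  · rintro g ((rfl | rfl) | ⟨n, hn, rfl | rfl⟩)
    · rw [norm_neg, hnorm]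
    · exact hnorm
    · rw [norm_neg, hd n hn]
    · exact hd n hn
  · rintro g ((rfl | rfl) | ⟨n, hn, rfl | rfl⟩)
    · left; right; rw [neg_neg]; rfl
    · left; left; rfl
    · right; exact ⟨n, hn, Or.inr (neg_neg _)⟩
    · right; exact ⟨n, hn, Or.inl rfl⟩
  · right; exact ⟨N + (m + 1), by omega, Or.inr rfl⟩
  · have hn : N + (m + 1) > N := by omega
    have hm : N + (m + 1) - 1 = N + m := by omega
    have h1 := htilde _ hn
    have h2 := hdk _ hn
    have h3 := hco _ hn
    have h4 := hq _ hn
    rw [hm] at h1 h2 h3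
    have hall : ∀ k ≥ N, |inner ℝ (r (N + m)) (d k)| ≤ q (N + (m + 1)) := fun k hk => by
      by_cases hkn : k = N + (m + 1)
      · rw [hkn, ← h3, abs_of_pos h4]
      · exact (h2 k hk hkn).le
    show ∀ x ∈ dictionary r d N ε,
      inner ℝ (r (N + m)) x ≤ inner ℝ (r (N + m)) (d (N + (m + 1)))
    rw [← h3]
    rintro g ((rfl | rfl) | ⟨n, hn, rfl | rfl⟩)
    · rw [inner_neg_right]; exact (neg_le_abs _).trans h1.le
    · exact (le_abs_self _).trans h1.le
    · rw [inner_neg_right]; exact (neg_le_abs _).trans (hall n hn)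
    · exact (le_abs_self _).trans (hall n hn)
  · have hn : N + (m + 1) > N := by omega
    have hm : N + (m + 1) - 1 = N + m := by omega
    have h1 := hres _ hn
    have h3 := hco _ hn
    rw [hm] at h1 h3
    show r (N + (m + 1)) = r (N + m)
      - (inner ℝ (r (N + m)) (d (N + (m + 1))) : ℝ) • d (N + (m + 1))
    rw [← h3, h1]

end

/-! ### Positivity of the mass of `φ` and splitting of the profile integrals -/

section
variable {β : ℝ} {φ : ℝ → ℝ} {δ B : ℝ}

/-- As `Φ` is bounded, `∫ φΦ ≤ C ∫ φ`. Positivity of `∫ φ` is what bounds the denominator of `α_n`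
away from zero and makes the contraction strict. -/
lemma IsCutoff.integral_pos (hφ : IsCutoff φ δ B)
    (h : 0 < ∫ x in (0 : ℝ)..1, φ x * profile φ x) : 0 < ∫ x in (0 : ℝ)..1, φ x := by
  have h0 : (0 : ℝ) ∈ Set.Icc (0 : ℝ) 1 := by simp
  have h1 : (1 : ℝ) ∈ Set.Icc (0 : ℝ) 1 := by simp
  have hΦ := hφ.lipBdd_profile
  set C := 1 + (B / δ + B / δ ^ 2)
  have hle : ∫ x in (0 : ℝ)..1, φ x * profile φ x ≤ ∫ x in (0 : ℝ)..1, C * φ x := by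
    refine intervalIntegral.integral_mono_on zero_le_one
      ((hφ.lipBdd.mul hΦ).intervalIntegrable h0 h1)
      ((hφ.lipBdd.intervalIntegrable h0 h1).const_mul _) fun x hx => ?_
    rw [mul_comm]
    exact mul_le_mul_of_nonneg_right ((le_abs_self _).trans (hΦ.bound x hx)) (hφ.nonneg x hx)
  rw [intervalIntegral.integral_const_mul] at hle
  exact pos_of_mul_pos_right (h.trans_le hle) hΦ.nonneg

lemma IsCutoff.integral_dirProfile_mul (hφ : IsCutoff φ δ B) {a : ℝ}
    (ha : a ∈ Set.Icc (0 : ℝ) 1) {C : ℝ} {f : ℝ → ℝ} (hf : LipBdd C f) :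
    ∫ x in (0 : ℝ)..1, dirProfile β φ x * f (a * x)
      = (∫ x in (0 : ℝ)..1, φ x * f (a * x))
        - (1 - β) * ∫ x in (0 : ℝ)..1, profile φ x * f (a * x) := by
  have h0 : (0 : ℝ) ∈ Set.Icc (0 : ℝ) 1 := by simp
  have h1 : (1 : ℝ) ∈ Set.Icc (0 : ℝ) 1 := by simp
  rw [← intervalIntegral.integral_const_mul, ← intervalIntegral.integral_sub
    ((hφ.lipBdd.mul (hf.comp_mul ha)).intervalIntegrable h0 h1)
    (((hφ.lipBdd_profile.mul (hf.comp_mul ha)).intervalIntegrable h0 h1).const_mul _)]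
  refine intervalIntegral.integral_congr fun x _ => ?_
  simp only [dirProfile]
  ring

lemma IsCutoff.integral_mul_dirProfile (hφ : IsCutoff φ δ B) {a : ℝ}
    (ha : a ∈ Set.Icc (0 : ℝ) 1) {C : ℝ} {f : ℝ → ℝ} (hf : LipBdd C f) :
    ∫ x in (0 : ℝ)..1, f x * dirProfile β φ (a * x)
      = (∫ x in (0 : ℝ)..1, f x * φ (a * x))
        - (1 - β) * ∫ x in (0 : ℝ)..1, f x * profile φ (a * x) := by
  have h0 : (0 : ℝ) ∈ Set.Icc (0 : ℝ) 1 := by simp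
  have h1 : (1 : ℝ) ∈ Set.Icc (0 : ℝ) 1 := by simp
  rw [← intervalIntegral.integral_const_mul, ← intervalIntegral.integral_sub
    ((hf.mul (hφ.lipBdd.comp_mul ha)).intervalIntegrable h0 h1)
    (((hf.mul (hφ.lipBdd_profile.comp_mul ha)).intervalIntegrable h0 h1).const_mul _)]
  refine intervalIntegral.integral_congr fun x _ => ?_
  simp only [dirProfile]
  ring

end

end PureGreedy

/-! ### Assembly of the main theorem -/

theorem proposition2 (β : ℝ) (hβ_pos : 0 < β) (hβ_lt : β < 1 / 2)
    (φ : ℝ → ℝ) (hφ_smooth : ContDiffOn ℝ ∞ φ (Set.Icc 0 1))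
    (hφ_nonneg : ∀ x ∈ Set.Icc (0 : ℝ) 1, 0 ≤ φ x)
    (hφ_zero : ∃ δ : ℝ, 0 < δ ∧ δ < 1 ∧ ∀ x ∈ Set.Icc (0 : ℝ) δ, φ x = 0)
    (hφ_eq : ∫ x in (0 : ℝ)..1, φ x * (1 + ∫ z in x..1, φ z / z) = β / (1 - 2 * β))
    (hφ_sup₁ : ∃ c < (1 : ℝ), ∀ a ∈ Set.Icc (0 : ℝ) 1,
      |∫ x in (0 : ℝ)..a,
          (derivWithin φ (Set.Icc 0 1) x * x - (β - 1) * φ x) *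
            (1 + ∫ z in (a⁻¹ * x)..1, φ z / z)| ≤ c)
    (hφ_sup₂ : ∃ c < (1 : ℝ), ∀ a ∈ Set.Icc (0 : ℝ) 1,
      |(∫ x in (0 : ℝ)..1,
          ((β - 1) + (β - 1) * (∫ z in x..1, φ z / z) + φ x) *
            (∫ z in (a * x)..x, φ z / z)) +
        ∫ x in a..1, φ x / x| ≤ c) :
    ∃ K₀ : ℕ, 1 < K₀ ∧ ∀ K ≥ K₀,
      ∃ (γ ξ α q : ℕ → ℝ) (r d : ℕ → ell2),
        IsIteration β φ K γ ξ α q r d ∧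
        IsAdmissible β K q r d ∧
        ∃ N₀ : ℕ, K ≤ N₀ ∧ ∀ N ≥ N₀,
          ∃ ε₀ : ℝ, 0 < ε₀ ∧ ε₀ ≤ 1 ∧ ∀ ε : ℝ, 0 < ε → ε < ε₀ →
            (∀ n > N,
              |inner ℝ (r (n - 1)) (dTilde r d N ε)| < q n ∧
              ∀ k ≥ N, k ≠ n → |inner ℝ (r (n - 1)) (d k)| < q n) ∧
            IsDictionary (dictionary r d N ε) ∧
            IsPureGreedyRun (dictionary r d N ε) (r N)
              (fun m => r (N + m)) (fun m => d (N + m)) := by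
  obtain ⟨δ, hδ, hδ1, hz⟩ := hφ_zero
  obtain ⟨hdc, hdd, B, hφ⟩ := IsCutoff.exists_of_contDiffOn hφ_smooth hφ_nonneg hδ hδ1 hz
  have hp : 0 < 1 - 2 * β := by linarith
  have heq : ∫ x in (0 : ℝ)..1, φ x * profile φ x = β / (1 - 2 * β) := hφ_eq
  have hA := hφ.integral_pos (by rw [heq]; positivity)
  have hΦ := hφ.lipBdd_profile
  obtain ⟨c₁, hc₁, hs₁⟩ := hφ_sup₁
  obtain ⟨c₂, hc₂, hs₂⟩ := hφ_sup₂
  have hsup₁ : ∀ a ∈ Set.Ioc (0 : ℝ) 1,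
      |a * (dirProfile β φ a + (∫ x in (0 : ℝ)..1, φ x * dirProfile β φ (a * x))
        - ∫ x in (0 : ℝ)..1, profile φ x * dirProfile β φ (a * x))| ≤ c₁ := by
    intro a ha
    have ha' : a ∈ Set.Icc (0 : ℝ) 1 := ⟨ha.1.le, ha.2⟩
    have h1 := hs₁ a ha'
    change |∫ x in (0 : ℝ)..a, (derivWithin φ (Set.Icc 0 1) x * x - (β - 1) * φ x) *
      profile φ (a⁻¹ * x)| ≤ c₁ at h1
    rw [hφ.integral_first_condition hdd hdc β ha.1 ha.2] at h1
    rw [hφ.integral_mul_dirProfile ha' hφ.lipBdd, hφ.integral_mul_dirProfile ha' hΦ, dirProfile]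
    refine le_of_eq_of_le ?_ h1
    congr 1
    ring
  have hsup₂ : ∀ a ∈ Set.Icc (0 : ℝ) 1,
      |(∫ x in (0 : ℝ)..1, dirProfile β φ x * profile φ (a * x)) + profile φ a| ≤ c₂ := by
    intro a ha
    have h1 := hs₂ a ha
    rw [hφ.integral_second_condition β ha, hφ.integral_profile_mul_profile, heq] at h1
    rw [hφ.integral_dirProfile_mul ha hΦ]
    -- The part of the second condition independent of `a` vanishes by the integral hypothesis,
    -- leaving the backward inner product limit itself.
    have hone : (1 - β) * (1 + 2 * (β / (1 - 2 * β))) - β / (1 - 2 * β) - 1 = 0 := by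
      linear_combination div_mul_cancel₀ β hp.ne'
    refine le_of_eq_of_le ?_ h1
    congr 1
    linear_combination -hone
  obtain ⟨a₀, a₁, ha₀, K₀, hK₀, H⟩ := exists_forall_stepBounds hβ_pos hβ_lt hφ hA
  refine ⟨K₀, hK₀, fun K hK => ?_⟩
  have hK1 : 1 < K := hK₀.trans_le hK
  have hK0 : 0 < K := by omega
  have hst := fun n hn => (H K hK n hn).1
  have hsq := fun n hn => (H K hK n hn).2.1
  have hb := fun n hn => (H K hK n hn).2.2
  obtain ⟨D, hD⟩ := exists_abs_coord_le hβ_lt hφ hK0 hst ha₀ hb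
  have hξ := tendsto_xi hβ_lt hφ hK0 hst ha₀ hb
  have hα := tendsto_alpha hβ_pos hβ_lt hφ hK0 hA heq hst ha₀ hb
  have hU := isProfile_coord hβ_lt hφ hD hξ hα
  have hit := isIteration (φ := φ) hβ_lt hK1
  have had := isAdmissible hK1 hst hsq
  refine ⟨_, _, _, _, _, _, hit, had, ?_⟩
  obtain ⟨c', hc', N₁, hN₁⟩ := exists_abs_dirDot_le hβ_lt hφ hU hα hξ hc₂ hsup₂
  obtain ⟨N₂, hN₂⟩ := exists_abs_dirDot_lt hβ_pos hβ_lt hφ hst hsq hU hα hξ hc₁ hsup₁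
  have hs := sqrt_one_sub_pos hβ_lt
  obtain ⟨N₃, hN₃⟩ :=
    ((tendsto_scaledCoeff hβ_lt).eventually_const_le (half_lt_self hs)).exists_forall_of_atTop
  refine ⟨max K (max N₁ (max N₂ N₃)), le_max_left _ _, fun N hN => ?_⟩
  simp only [ge_iff_le, max_le_iff] at hN
  obtain ⟨hKN, hN1, hN2, hN3⟩ := hN
  obtain ⟨C, hC0, hC⟩ := exists_abs_inner_resid_le hD N
  have habs : ∀ n > N, ∀ k, |inner ℝ (resid β φ K (n - 1)) (dir β φ K k)|
      = (n : ℝ) ^ (β - 1) * |dirDot β φ K n k| := fun n hn k => by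
    rw [inner_resid_dir (by omega), abs_mul, abs_neg, abs_of_nonneg (by positivity)]
  have hback : ∀ n > N, ∀ k ≥ N, k < n →
      |inner ℝ (resid β φ K (n - 1)) (dir β φ K k)| ≤ c' * greedyCoeff β n := by
    intro n hn k hk hkn
    rw [habs n hn, greedyCoeff_eq (by omega)]
    have := mul_le_mul_of_nonneg_left (hN₁ k (hN1.trans hk) n hkn)
      (by positivity : (0 : ℝ) ≤ (n : ℝ) ^ (β - 1))
    linarith
  have hqpos : ∀ n > N, 0 < greedyCoeff β n := fun n hn => greedyCoeff_pos hβ_lt (by omega)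
  refine exists_dictionary_run (fun n hn => hit.residual n (by omega)) hqpos
    (fun n hn => had.coeff n (by omega)) (fun n hn => had.norm_direction n (by omega)) ?_ ?_
    hc' (div_nonneg hC0 (half_pos hs).le) (fun n hn => hback n hn N le_rfl hn) ?_ ?_
  · rw [had.norm_residual N hKN]
    positivity
  -- A greedy step leaves the residual orthogonal to the direction just used.
  · rw [hit.residual N hKN, inner_sub_left, real_inner_smul_left, ← had.coeff N hKN,
      real_inner_self_eq_norm_sq, had.norm_direction N hKN]
    ring
  · intro n hn
    refine (hC n hn).trans ?_
    rw [greedyCoeff_eq (by omega)]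
    have h1 := hN₃ n (by omega)
    have h2 : C = C / (√(1 - 2 * β) / 2) * (√(1 - 2 * β) / 2) := by field_simp
    have h3 : 0 ≤ C / (√(1 - 2 * β) / 2) := by positivity
    have h4 := mul_le_mul_of_nonneg_left h1 h3
    rw [← h2] at h4
    have h5 := mul_le_mul_of_nonneg_right h4 (by positivity : (0 : ℝ) ≤ (n : ℝ) ^ (β - 1))
    linarith
  · intro n hn k hk hkn
    -- Earlier directions are controlled by the uniform factor `c'`, later ones by the backward
    -- induction.
    rcases lt_or_gt_of_ne hkn with h | h
    · refine (hback n hn k hk h).trans_lt ?_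
      have := mul_lt_mul_of_pos_right hc' (hqpos n hn)
      linarith
    · rw [habs n hn, greedyCoeff_eq (by omega)]
      have hn0 : (0 : ℝ) < n := by exact_mod_cast (by omega : 0 < n)
      exact mul_lt_mul_of_pos_left (hN₂ n (by omega) k h) (Real.rpow_pos_of_pos hn0 _)
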